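/- Write $\mathbb R_+=(0,\infty)$, $\mathbf 1=(1,\dots,1)$, $|\mathbf t|^{\mathbf s}=|t_1|^{s_1}\cdots|t_d|^{s_d}$ for $\mathbf t,\mathbf s\in\mathbb R^d$. For functions on $\mathbb R^d$ let $\widehat x(\mathbf u)=\int_{\mathbb R^d}x(\mathbf t)e^{-2\pi i\langle \mathbf t,\mathbf u\rangle}\,d\mathbf t$ be the Fourier transform, understood in the sense of tempered distributions (so it is the Plancherel transform on $L_2(\mathbb R^d)$); "$\widehat x$ is a function" means that the functions $x$ and $\widehat x$ are both integrable against every Schwartz function $\varphi$ and $\int x\,\widehat\varphi=\int\widehat x\,\varphi$ for all such $\varphi$. For $\mathbf r\in\mathbb R^d$ let $\mathcal L^{\mathbf r}$ be the space of measurable $x:\mathbb R^d\to\mathbb C$ whose Fourier transform is a function with $\int_{\mathbb R^d}|2\pi\mathbf u|^{2\mathbf r}|\widehat x(\mathbf u)|^2\,d\mathbf u<\infty$, and for $\mathbf k\in\mathbb R^d$ let $\mathcal D^{\mathbf k}x$ be the function with $$\widehat{\mathcal D^{\mathbf k}x}(\mathbf u)=\prod_{j=1}^d(2\pi i u_j)^{k_j}\;\widehat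 x(\mathbf u),\qquad (2\pi i a)^b:=|2\pi a|^b e^{\frac{i\pi b\,\mathrm{sign}\,a}{2}} .$$ **Theorem 5.9.** Let $d,m\in\mathbb N$ (positive integers), $\mathbf k,\mathbf r^0,\dots,\mathbf r^m\in\mathbb R^d$ and $\lambda_0,\dots,\lambda_m>0$ be such that $\lambda_0+\dots+\lambda_m=1$ and $\mathbf k+\frac12\mathbf 1=\lambda_0\mathbf r^0+\dots+\lambda_m\mathbf r^m$ lies in the interior of the convex hull of $\mathbf r^0,\dots,\mathbf r^m$. Put $$\mathcal C=\frac1{\pi^d}\sup_{\mathbf h\in\mathbb R_+^{m+1}}\prod_{j=0}^m h_j^{\lambda_j}\int_{\mathbb R_+^d}\frac{\mathbf t^{2\mathbf k}\,d\mathbf t}{\sum_{l=0}^m h_l\mathbf t^{2\mathbf r^l}} .$$ Then: 1. $\mathcal C<\infty$ and, with $\mathfrak c_{\mathbf n}=\prod_{j=1}^d[n_j-\frac12,n_j+\frac12]$, $$\mathcal C=\liminf_{\rho\to0^+}\ \sup_{\mathbf h\in\mathbb R_+^{m+1}}\prod_{j=0}^m h_j^{\lambda_j}\sum_{\mathbf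 n\in\mathbb Z^d:\ n_1\cdots n_d\ne0}\frac{\rho^d\left(\int_{\mathfrak c_{\mathbf n}}(2\pi\rho|\mathbf t|)^{\mathbf k}\,d\mathbf t\right)^2}{\sum_{l=0}^m h_l\int_{\mathfrak c_{\mathbf n}}(2\pi\rho|\mathbf t|)^{2\mathbf r^l}\,d\mathbf t},$$ where $(2\pi\rho|\mathbf t|)^{\mathbf s}:=\prod_{j=1}^d(2\pi\rho|t_j|)^{s_j}$. 2. For every $x\in\bigcap_{l=0}^m\mathcal L^{\mathbf r^l}$, $\mathcal D^{\mathbf k}x$ exists as a unique bounded continuous function, each $\mathcal D^{\mathbf r^l}x$ exists as a unique element of $L_2(\mathbb R^d)$, and $$\|\mathcal D^{\mathbf k}x\|_{C(\mathbb R^d)}\le\sqrt{\mathcal C\prod_{j=0}^m\lambda_j^{-\lambda_j}}\ \prod_{j=0}^m\|\mathcal D^{\mathbf r^j}x\|_{L_2(\mathbb R^d)}^{\lambda_j},$$ where $\|\cdot\|_{C(\mathbb R^d)}$ is the supremum norm. 3. The inequality is sharp: for every real $K<\sqrt{\mathcal C\prod_j\lambda_j^{-\lambda_j}}$ there is $x\in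 L_2(\mathbb R^d)\cap\bigcap_{l=0}^m\mathcal L^{\mathbf r^l}$ with $\|\mathcal D^{\mathbf k}x\|_{C(\mathbb R^d)}>K\prod_{j=0}^m\|\mathcal D^{\mathbf r^j}x\|_{L_2(\mathbb R^d)}^{\lambda_j}$. -/

import Mathlib

open MeasureTheory Filter Topology
open scoped FourierTransform SchwartzMap BoundedContinuousFunction ENNReal

noncomputable section

namespace TaikovRd

/-- The generalized monomial `|t|^s = |t_1|^{s_1} ⋯ |t_d|^{s_d}` with real exponents. -/
def absPow {d : ℕ} (t : EuclideanSpace ℝ (Fin d)) (s : Fin d → ℝ) : ℝ :=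
  ∏ i, |t i| ^ s i

/-- The symbol `(2πi u_1)^{k_1} ⋯ (2πi u_d)^{k_d}`, where
`(2πi a)^b = |2πa|^b · exp(iπ b sign(a) / 2)` for real `a`, `b`. -/
def symbol {d : ℕ} (k : Fin d → ℝ) (u : EuclideanSpace ℝ (Fin d)) : ℂ :=
  ∏ i, (((|2 * Real.pi * u i| ^ k i : ℝ) : ℂ) *
    Complex.exp (Complex.I * ((Real.pi * k i * Real.sign (u i) / 2 : ℝ) : ℂ)))

/-- `g` is the Fourier transform of the function `f`, for the normalization
`f̂(u) = ∫ f(t) e^{-2πi⟨t,u⟩} dt`. The relation is tested against Schwartz functions, so that it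
is the integral formula for integrable `f` and the Plancherel transform for square integrable `f`;
in general `f` is a function that is a tempered distribution whose Fourier transform is the
function `g`. It determines `g` from `f`, and `f` from `g`, up to null sets. -/
def HasFourierTransform {d : ℕ} (f g : EuclideanSpace ℝ (Fin d) → ℂ) : Prop :=
  AEStronglyMeasurable f ∧ AEStronglyMeasurable g ∧
    ∀ φ : 𝓢(EuclideanSpace ℝ (Fin d), ℂ),
      Integrable (fun t => f t * φ t) ∧ Integrable (fun u => g u * φ u) ∧
        ∫ t, f t * (𝓕 φ) t = ∫ u, g u * φ u

/-- Membership of `x` in the Sobolev space `𝓛^r`: the Fourier transform `x̂` of `x` is a function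
with `∫ |2πu|^{2r} |x̂(u)|² du < ∞`. -/
def MemSobolev {d : ℕ} (r : Fin d → ℝ) (x : EuclideanSpace ℝ (Fin d) → ℂ) : Prop :=
  ∃ g, HasFourierTransform x g ∧
    ∫⁻ u, ENNReal.ofReal (absPow ((2 * Real.pi) • u) (fun i => 2 * r i) * ‖g u‖ ^ 2) < ⊤

/-- `y = 𝓓^k x`, that is, `ŷ(u) = (2πi u_1)^{k_1} ⋯ (2πi u_d)^{k_d} x̂(u)`. -/
def IsFracDeriv {d : ℕ} (k : Fin d → ℝ) (x y : EuclideanSpace ℝ (Fin d) → ℂ) : Prop :=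
  ∃ g, HasFourierTransform x g ∧ HasFourierTransform y (fun u => symbol k u * g u)

/-- The constant
`π^{-d} sup_{h > 0} ∏ h_j^{λ_j} ∫_{t > 0} t^{2k} / (∑ h_l t^{2 r^l}) dt`, as an extended
nonnegative number. -/
def taikovConst {d m : ℕ} (k : Fin d → ℝ) (r : Fin (m + 1) → Fin d → ℝ)
    (lam : Fin (m + 1) → ℝ) : ℝ≥0∞ :=
  ENNReal.ofReal ((Real.pi ^ d)⁻¹) *
    ⨆ (h : Fin (m + 1) → ℝ) (_ : ∀ j, 0 < h j),
      ENNReal.ofReal (∏ j, h j ^ lam j) *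
        ∫⁻ t in {t : EuclideanSpace ℝ (Fin d) | ∀ i, 0 < t i},
          ENNReal.ofReal (absPow t (fun i => 2 * k i) /
            ∑ l, h l * absPow t (fun i => 2 * r l i))

/-- The closed unit cube centred at the integer point `n`. -/
def unitCube {d : ℕ} (n : Fin d → ℤ) : Set (EuclideanSpace ℝ (Fin d)) :=
  {t | ∀ i, |t i - n i| ≤ 1 / 2}

/-- For a mesh size `ρ > 0`, the discretized constant
`sup_{h > 0} ∏ h_j^{λ_j} ∑_n ρ^d (∫_{c_n} (2πρ|t|)^k dt)² / ∑ h_l ∫_{c_n} (2πρ|t|)^{2 r^l} dt`,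
the sum being over all `n ∈ ℤ^d` without zero coordinates and `c_n` the unit cube about `n`. -/
def meshConst {d m : ℕ} (k : Fin d → ℝ) (r : Fin (m + 1) → Fin d → ℝ)
    (lam : Fin (m + 1) → ℝ) (ρ : ℝ) : ℝ≥0∞ :=
  ⨆ (h : Fin (m + 1) → ℝ) (_ : ∀ j, 0 < h j),
    ENNReal.ofReal (∏ j, h j ^ lam j) *
      ∑' n : {n : Fin d → ℤ // ∀ i, n i ≠ 0},
        ENNReal.ofReal (ρ ^ d * (∫ t in unitCube n.1, absPow ((2 * Real.pi * ρ) • t) k) ^ 2 /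
          ∑ l, h l * ∫ t in unitCube n.1, absPow ((2 * Real.pi * ρ) • t) (fun i => 2 * r l i))

end TaikovRd

end

/-! Let g be the Fourier transform of x and S_h(u) = ∑ h_l |2πu|^{2r^l}. Fourier inversion bounds
D^k x by ∫ |2πu|^k |g|. Cauchy–Schwarz with weight S_h bounds the square of this integral by ∫
|2πu|^{2k} / S_h times ∫ S_h |g|² = ∑ h_l ‖D^{r^l} x‖². The first factor is at most C / ∏ h_j^{λ_j},
and h_j = λ_j / ‖D^{r^j} x‖² gives the inequality (`integral_norm_symbol_mul_le`).

Equality in Cauchy–Schwarz holds when g is the conjugate symbol divided by S_h; D^k x is then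
largest at the origin, and the weighted AM–GM inequality replaces the sum of squared norms by their
product. Truncating g to a box away from the coordinate hyperplanes makes all integrals finite, and
a nearly optimal h with a large box gives sharpness (`exists_lt_norm_fracDeriv`).

Finiteness of C is seen in logarithmic coordinates, where the terms of S_h are exponentials of
affine functions. Since k + 1/2 is interior to the hull of the r^l, the largest of these functions
exceeds their λ-mean by a multiple of the distance to some centre. Only the centre depends on h, so
a translation-invariant integral bounds C uniformly (`exists_affine_max_lower_bound`,
`taikovConst_ne_top`).

For the mesh formula, Cauchy–Schwarz on each cube shows that every mesh constant is at most C, and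
Fatou's lemma applied to step functions gives the opposite bound for the lower limit. -/

noncomputable section

namespace TaikovRd

/-! ### Distributional Fourier transform: uniqueness and inversion in L₁ and L₂ -/

/-- A function that is integrable against all Schwartz functions is locally integrable. -/
theorem locallyIntegrable_of_schwartz {d : ℕ} {f : EuclideanSpace ℝ (Fin d) → ℂ}
    (hf : ∀ φ : 𝓢(EuclideanSpace ℝ (Fin d), ℂ), Integrable (fun t => f t * φ t)) :
    LocallyIntegrable f := by
  intro x
  let b : ContDiffBump x := ⟨1, 2, by norm_num, by norm_num⟩
  have hb : HasCompactSupport (fun t => ((b t : ℝ) : ℂ)) :=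
    b.hasCompactSupport.comp_left (g := fun y : ℝ => (y : ℂ)) (by simp)
  have hs : ContDiff ℝ (↑(⊤ : ℕ∞)) (fun t => ((b t : ℝ) : ℂ)) :=
    Complex.ofRealCLM.contDiff.comp b.contDiff
  have h := hf (hb.toSchwartzMap hs)
  refine ⟨Metric.closedBall x 1, Metric.closedBall_mem_nhds x one_pos, ?_⟩
  refine (h.integrableOn (s := Metric.closedBall x 1)).congr_fun (fun t ht => ?_)
    Metric.isClosed_closedBall.measurableSet
  have : b t = 1 := b.one_of_mem_closedBall ht
  simp [this]

/-- Functions that agree as tempered distributions agree almost everywhere. -/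
theorem ae_eq_of_integral_schwartz_eq {d : ℕ} {f g : EuclideanSpace ℝ (Fin d) → ℂ}
    (hf : ∀ φ : 𝓢(EuclideanSpace ℝ (Fin d), ℂ), Integrable (fun t => f t * φ t))
    (hg : ∀ φ : 𝓢(EuclideanSpace ℝ (Fin d), ℂ), Integrable (fun t => g t * φ t))
    (h : ∀ φ : 𝓢(EuclideanSpace ℝ (Fin d), ℂ), ∫ t, f t * φ t = ∫ t, g t * φ t) :
    f =ᵐ[volume] g := by
  refine ae_eq_of_integral_contDiff_smul_eq (locallyIntegrable_of_schwartz hf)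
    (locallyIntegrable_of_schwartz hg) (fun b hb hb' => ?_)
  have hc : HasCompactSupport (fun t => ((b t : ℝ) : ℂ)) :=
    hb'.comp_left (g := fun y : ℝ => (y : ℂ)) (by simp)
  have hs : ContDiff ℝ (↑(⊤ : ℕ∞)) (fun t => ((b t : ℝ) : ℂ)) :=
    Complex.ofRealCLM.contDiff.comp hb
  simpa [mul_comm] using h (hc.toSchwartzMap hs)

theorem HasFourierTransform.ae_eq_right {d : ℕ} {f g g' : EuclideanSpace ℝ (Fin d) → ℂ}
    (h : HasFourierTransform f g) (h' : HasFourierTransform f g') : g =ᵐ[volume] g' :=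
  ae_eq_of_integral_schwartz_eq (fun φ => (h.2.2 φ).2.1) (fun φ => (h'.2.2 φ).2.1)
    (fun φ => (h.2.2 φ).2.2.symm.trans (h'.2.2 φ).2.2)

theorem HasFourierTransform.ae_eq_left {d : ℕ} {f f' g g' : EuclideanSpace ℝ (Fin d) → ℂ}
    (h : HasFourierTransform f g) (h' : HasFourierTransform f' g') (hg : g =ᵐ[volume] g') :
    f =ᵐ[volume] f' := by
  refine ae_eq_of_integral_schwartz_eq (fun φ => (h.2.2 φ).1) (fun φ => (h'.2.2 φ).1)
    (fun φ => ?_)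
  -- Every Schwartz function is the transform of a Schwartz function, so testing with `𝓕⁻ φ` reaches
  -- every test function on the left side.
  have e1 := (h.2.2 (𝓕⁻ φ)).2.2
  have e2 := (h'.2.2 (𝓕⁻ φ)).2.2
  rw [FourierTransform.fourier_fourierInv_eq] at e1 e2
  rw [e1, e2]
  refine integral_congr_ae ?_
  filter_upwards [hg] with u hu
  rw [hu]

theorem HasFourierTransform.congr_right {d : ℕ} {f g g' : EuclideanSpace ℝ (Fin d) → ℂ}
    (h : HasFourierTransform f g) (hg : g =ᵐ[volume] g') : HasFourierTransform f g' := by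
  refine ⟨h.1, h.2.1.congr hg, fun φ => ?_⟩
  have e : (fun u => g u * φ u) =ᵐ[volume] fun u => g' u * φ u := by
    filter_upwards [hg] with u hu
    rw [hu]
  exact ⟨(h.2.2 φ).1, (h.2.2 φ).2.1.congr e, (h.2.2 φ).2.2.trans (integral_congr_ae e)⟩

theorem continuous_fourierInv {d : ℕ} {g : EuclideanSpace ℝ (Fin d) → ℂ} (hg : Integrable g) :
    Continuous (𝓕⁻ g) := by
  rw [Real.fourierInv_eq_fourier_comp_neg]
  exact VectorFourier.fourierIntegral_continuous Real.continuous_fourierChar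
    continuous_inner hg.comp_neg

theorem norm_fourierInv_le {d : ℕ} (g : EuclideanSpace ℝ (Fin d) → ℂ)
    (v : EuclideanSpace ℝ (Fin d)) : ‖(𝓕⁻ g) v‖ ≤ ∫ u, ‖g u‖ := by
  rw [Real.fourierInv_eq]
  refine (norm_integral_le_integral_norm _).trans (le_of_eq ?_)
  simp

/-- The inverse Fourier transform of an integrable function, as a bounded continuous function. -/
def fourierInvBCF {d : ℕ} (g : EuclideanSpace ℝ (Fin d) → ℂ) (hg : Integrable g) :
    EuclideanSpace ℝ (Fin d) →ᵇ ℂ :=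
  BoundedContinuousFunction.ofNormedAddCommGroup (𝓕⁻ g) (continuous_fourierInv hg) (∫ u, ‖g u‖)
    (norm_fourierInv_le g)

theorem norm_fourierInvBCF_le {d : ℕ} (g : EuclideanSpace ℝ (Fin d) → ℂ) (hg : Integrable g) :
    ‖fourierInvBCF g hg‖ ≤ ∫ u, ‖g u‖ :=
  BoundedContinuousFunction.norm_ofNormedAddCommGroup_le _
    (integral_nonneg fun _ => norm_nonneg _) (norm_fourierInv_le g)

theorem fourierInvBCF_zero {d : ℕ} (g : EuclideanSpace ℝ (Fin d) → ℂ) (hg : Integrable g) :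
    fourierInvBCF g hg 0 = ∫ u, g u := by
  change (𝓕⁻ g) 0 = _
  rw [Real.fourierInv_eq]
  simp

theorem hasFourierTransform_fourierInv {d : ℕ} {g : EuclideanSpace ℝ (Fin d) → ℂ}
    (hg : Integrable g) : HasFourierTransform (𝓕⁻ g) g := by
  have hc := continuous_fourierInv hg
  refine ⟨hc.aestronglyMeasurable, hg.1, fun φ => ⟨?_, ?_, ?_⟩⟩
  · exact φ.integrable.bdd_mul hc.aestronglyMeasurable
      (Eventually.of_forall (norm_fourierInv_le g))
  · exact hg.mul_bdd (c := ‖φ.toBoundedContinuousFunction‖) φ.continuous.aestronglyMeasurable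
      (Eventually.of_forall fun x => φ.toBoundedContinuousFunction.norm_coe_le_norm x)
  -- The multiplication formula (Fubini) for g(-·) and `𝓕 φ` moves the transform onto `𝓕 φ`;
  -- inversion of Schwartz functions then returns φ.
  · have h1 := VectorFourier.integral_fourierIntegral_smul_eq_flip
      (L := innerₗ (EuclideanSpace ℝ (Fin d))) (μ := volume) (ν := volume)
      Real.continuous_fourierChar continuous_inner hg.comp_neg (𝓕 φ).integrable
    have e : (𝓕⁻ g) = VectorFourier.fourierIntegral Real.fourierChar volume
        (innerₗ (EuclideanSpace ℝ (Fin d))) (fun x => g (-x)) := by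
      rw [Real.fourierInv_eq_fourier_comp_neg]; rfl
    simp only [smul_eq_mul, flip_innerₗ] at h1
    rw [e, h1, ← integral_neg_eq_self (fun u => g u * φ u)]
    refine integral_congr_ae (Eventually.of_forall fun x => ?_)
    have e2 : φ (-x) = (𝓕⁻ (𝓕 φ)) (-x) := by
      rw [FourierTransform.fourierInv_fourier_eq]
    dsimp only
    rw [e2, SchwartzMap.fourierInv_coe, Real.fourierInv_eq_fourier_neg, neg_neg]
    rfl

theorem integrable_memLp_mul_schwartz {d : ℕ} {f : EuclideanSpace ℝ (Fin d) → ℂ}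
    (hf : MemLp f 2) (φ : 𝓢(EuclideanSpace ℝ (Fin d), ℂ)) : Integrable (fun t => f t * φ t) :=
  hf.integrable_mul (φ.memLp 2)

/-- The Plancherel transform agrees with the transform of tempered distributions, and the latter is
defined by the tested identity. -/
theorem hasFourierTransform_fourierInv_Lp {d : ℕ}
    (G : Lp ℂ 2 (volume : Measure (EuclideanSpace ℝ (Fin d)))) :
    HasFourierTransform (𝓕⁻ G : Lp ℂ 2 (volume : Measure (EuclideanSpace ℝ (Fin d)))) G := by
  refine ⟨Lp.aestronglyMeasurable _, Lp.aestronglyMeasurable _, fun φ =>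
    ⟨integrable_memLp_mul_schwartz (Lp.memLp _) φ, integrable_memLp_mul_schwartz (Lp.memLp _) φ, ?_⟩⟩
  have h := Lp.fourier_toTemperedDistribution_eq (𝓕⁻ G)
  rw [FourierTransform.fourier_fourierInv_eq] at h
  have h2 := congrArg (fun T => T φ) h
  simp only [TemperedDistribution.fourier_apply, Lp.toTemperedDistribution_apply,
    smul_eq_mul] at h2
  simpa only [mul_comm] using h2

theorem norm_fourierInv_Lp {d : ℕ} (G : Lp ℂ 2 (volume : Measure (EuclideanSpace ℝ (Fin d)))) :
    ‖(𝓕⁻ G : Lp ℂ 2 (volume : Measure (EuclideanSpace ℝ (Fin d))))‖ = ‖G‖ := by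
  rw [← Lp.norm_fourier_eq, FourierTransform.fourier_fourierInv_eq]

/-! ### Monomials and symbols -/

theorem measurable_absPow {d : ℕ} (s : Fin d → ℝ) :
    Measurable (fun t : EuclideanSpace ℝ (Fin d) => absPow t s) := by
  unfold absPow
  fun_prop

theorem absPow_nonneg {d : ℕ} (t : EuclideanSpace ℝ (Fin d)) (s : Fin d → ℝ) : 0 ≤ absPow t s :=
  Finset.prod_nonneg fun _ _ => Real.rpow_nonneg (abs_nonneg _) _

theorem absPow_pos {d : ℕ} {t : EuclideanSpace ℝ (Fin d)} (ht : ∀ i, t i ≠ 0) (s : Fin d → ℝ) :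
    0 < absPow t s :=
  Finset.prod_pos fun i _ => Real.rpow_pos_of_pos (abs_pos.2 (ht i)) _

theorem absPow_two_mul {d : ℕ} (t : EuclideanSpace ℝ (Fin d)) (s : Fin d → ℝ) :
    absPow t (fun i => 2 * s i) = absPow t s ^ 2 := by
  unfold absPow
  rw [← Finset.prod_pow]
  refine Finset.prod_congr rfl fun i _ => ?_
  rw [← Real.rpow_mul_natCast (abs_nonneg _), mul_comm]
  norm_num

theorem absPow_congr_abs {d : ℕ} {t t' : EuclideanSpace ℝ (Fin d)} (h : ∀ i, |t i| = |t' i|)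
    (s : Fin d → ℝ) : absPow t s = absPow t' s := by
  unfold absPow
  simp only [h]

theorem continuousAt_absPow {d : ℕ} {t : EuclideanSpace ℝ (Fin d)} (ht : ∀ i, t i ≠ 0)
    (s : Fin d → ℝ) : ContinuousAt (fun u => absPow u s) t := by
  unfold absPow
  refine tendsto_finsetProd _ fun i _ => ?_
  refine ContinuousAt.rpow_const ?_ (Or.inl (abs_ne_zero.2 (ht i)))
  fun_prop

theorem volume_coord_eq {d : ℕ} (i : Fin d) (c : ℝ) :
    volume {t : EuclideanSpace ℝ (Fin d) | t i = c} = 0 := by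
  have h : (volume : Measure (Fin d → ℝ)) (Function.eval i ⁻¹' {c}) = 0 :=
    Measure.pi_hyperplane (fun _ : Fin d => (volume : Measure ℝ)) i c
  exact (EuclideanSpace.volume_preserving_symm_measurableEquiv_toLp
    (Fin d)).quasiMeasurePreserving.preimage_null h

/-- Off the coordinate hyperplanes all monomials are positive and continuous, whatever the signs of
the exponents; on them negative powers only have default values. -/
theorem ae_coord_ne_zero {d : ℕ} :
    ∀ᵐ t : EuclideanSpace ℝ (Fin d), ∀ i, t i ≠ 0 := by
  rw [ae_all_iff]
  intro i
  rw [ae_iff]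
  simpa using volume_coord_eq i 0

theorem norm_symbol {d : ℕ} (k : Fin d → ℝ) (u : EuclideanSpace ℝ (Fin d)) :
    ‖symbol k u‖ = absPow ((2 * Real.pi) • u) k := by
  unfold symbol absPow
  rw [norm_prod]
  refine Finset.prod_congr rfl fun i _ => ?_
  rw [norm_mul, mul_comm Complex.I, Complex.norm_exp_ofReal_mul_I, mul_one, Complex.norm_real,
    Real.norm_of_nonneg (Real.rpow_nonneg (abs_nonneg _) _)]
  simp

theorem measurable_symbol {d : ℕ} (k : Fin d → ℝ) :
    Measurable (symbol k : EuclideanSpace ℝ (Fin d) → ℂ) := by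
  have hs : Measurable Real.sign := by
    unfold Real.sign
    exact Measurable.ite measurableSet_Iio measurable_const
      (Measurable.ite measurableSet_Ioi measurable_const measurable_const)
  unfold symbol
  refine Finset.measurable_prod _ fun i _ => ?_
  have h1 : Measurable fun u : EuclideanSpace ℝ (Fin d) => Real.sign (u i) :=
    hs.comp (by fun_prop)
  fun_prop

theorem symbol_ne_zero {d : ℕ} (k : Fin d → ℝ) {u : EuclideanSpace ℝ (Fin d)}
    (hu : ∀ i, u i ≠ 0) : symbol k u ≠ 0 := by
  rw [← norm_pos_iff, norm_symbol]
  exact absPow_pos (fun i => by simpa [Real.pi_ne_zero] using hu i) k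

/-! ### The integrand of the constant, on the orthant and on the whole space -/

/-- The denominator `∑ h_l |t|^{2 r^l}`. -/
def powSum {d m : ℕ} (r : Fin (m + 1) → Fin d → ℝ) (h : Fin (m + 1) → ℝ)
    (t : EuclideanSpace ℝ (Fin d)) : ℝ :=
  ∑ l, h l * absPow t (fun i => 2 * r l i)

/-- The quotient `|t|^{2k} / ∑ h_l |t|^{2 r^l}`. -/
def powRatio {d m : ℕ} (k : Fin d → ℝ) (r : Fin (m + 1) → Fin d → ℝ) (h : Fin (m + 1) → ℝ)
    (t : EuclideanSpace ℝ (Fin d)) : ℝ :=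
  absPow t (fun i => 2 * k i) / powSum r h t

section PowRatio

variable {d m : ℕ} {k : Fin d → ℝ} {r : Fin (m + 1) → Fin d → ℝ} {h : Fin (m + 1) → ℝ}

theorem measurable_powSum : Measurable (powSum r h) :=
  Finset.measurable_sum _ fun _ _ => (measurable_absPow _).const_mul _

theorem measurable_powRatio : Measurable (powRatio k r h) :=
  (measurable_absPow _).div measurable_powSum

theorem powSum_nonneg (hh : ∀ j, 0 < h j) (t : EuclideanSpace ℝ (Fin d)) : 0 ≤ powSum r h t :=
  Finset.sum_nonneg fun l _ => mul_nonneg (hh l).le (absPow_nonneg _ _)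

theorem powSum_pos (hh : ∀ j, 0 < h j) {t : EuclideanSpace ℝ (Fin d)} (ht : ∀ i, t i ≠ 0) :
    0 < powSum r h t :=
  Finset.sum_pos (fun l _ => mul_pos (hh l) (absPow_pos ht _)) Finset.univ_nonempty

theorem powRatio_nonneg (hh : ∀ j, 0 < h j) (t : EuclideanSpace ℝ (Fin d)) :
    0 ≤ powRatio k r h t :=
  div_nonneg (absPow_nonneg _ _) (powSum_nonneg hh t)

theorem powRatio_pos (hh : ∀ j, 0 < h j) {t : EuclideanSpace ℝ (Fin d)} (ht : ∀ i, t i ≠ 0) :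
    0 < powRatio k r h t :=
  div_pos (absPow_pos ht _) (powSum_pos hh ht)

theorem powRatio_congr_abs {t t' : EuclideanSpace ℝ (Fin d)} (ht : ∀ i, |t i| = |t' i|) :
    powRatio k r h t = powRatio k r h t' := by
  unfold powRatio powSum
  simp only [absPow_congr_abs ht]

end PowRatio

theorem lintegral_comp_smul {d : ℕ} {c : ℝ} (hc : 0 < c)
    {F : EuclideanSpace ℝ (Fin d) → ℝ≥0∞} (hF : Measurable F) :
    ∫⁻ u, F (c • u) = ENNReal.ofReal ((c ^ d)⁻¹) * ∫⁻ t, F t := by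
  have h := Measure.map_addHaar_smul (volume : Measure (EuclideanSpace ℝ (Fin d))) hc.ne'
  rw [← lintegral_map hF (measurable_const_smul c), h, lintegral_smul_measure]
  simp [abs_of_pos hc]

/-- The integral of a function of `|t_1|, …, |t_d|` is `2^d` times its integral over the positive
orthant. -/
theorem lintegral_eq_two_pow_mul_orthant {d : ℕ} {F : EuclideanSpace ℝ (Fin d) → ℝ≥0∞}
    (hF : ∀ t t' : EuclideanSpace ℝ (Fin d), (∀ i, |t i| = |t' i|) → F t = F t') :
    ∫⁻ t, F t = 2 ^ d * ∫⁻ t in {t : EuclideanSpace ℝ (Fin d) | ∀ i, 0 < t i}, F t := by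
  -- The 2^d coordinate reflections carry the orthants onto each other, preserving both the measure
  -- and F.
  let e : (Fin d → Bool) → EuclideanSpace ℝ (Fin d) ≃ₗᵢ[ℝ] EuclideanSpace ℝ (Fin d) := fun σ =>
    LinearIsometryEquiv.piLpCongrRight 2 fun i =>
      if σ i then LinearIsometryEquiv.neg ℝ else LinearIsometryEquiv.refl ℝ ℝ
  have he : ∀ σ t i, e σ t i = if σ i then - t i else t i := by
    intro σ t i
    simp only [e, LinearIsometryEquiv.piLpCongrRight_apply]
    split_ifs <;> simp
  let P : Set (EuclideanSpace ℝ (Fin d)) := {t | ∀ i, 0 < t i}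
  have hP : MeasurableSet P := by
    have : P = ⋂ i, {t : EuclideanSpace ℝ (Fin d) | 0 < t i} := by ext; simp [P]
    rw [this]
    exact MeasurableSet.iInter fun i => measurableSet_lt measurable_const (by fun_prop)
  have hO : ∀ σ, ∫⁻ t in e σ ⁻¹' P, F t = ∫⁻ t in P, F t := by
    intro σ
    have hmp := (e σ).measurePreserving
    rw [← hmp.setLIntegral_comp_preimage_emb (e σ).toHomeomorph.measurableEmbedding F P]
    refine lintegral_congr fun t => hF _ _ fun i => ?_
    rw [he]
    split_ifs <;> simp
  have hd : Pairwise (Function.onFun Disjoint fun σ => e σ ⁻¹' P) := by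
    intro σ τ hστ
    rw [Function.onFun, Set.disjoint_left]
    intro t h1 h2
    refine hστ (funext fun i => ?_)
    have a1 := h1 i
    have a2 := h2 i
    rw [he] at a1 a2
    cases hs : σ i <;> cases ht : τ i <;> simp [hs, ht] at a1 a2 ⊢ <;> linarith
  have hU : (⋃ σ, e σ ⁻¹' P) =ᵐ[volume] Set.univ := by
    rw [eventuallyEq_univ]
    filter_upwards [ae_coord_ne_zero (d := d)] with t ht
    refine Set.mem_iUnion.2 ⟨fun i => decide (t i < 0), fun i => ?_⟩
    rw [he]
    rcases lt_or_gt_of_ne (ht i) with h | h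
    · simp [h]
    · simpa [not_lt.2 h.le] using h
  rw [← setLIntegral_univ, ← setLIntegral_congr hU,
    lintegral_iUnion (fun σ => (e σ).continuous.measurable hP) hd, tsum_fintype]
  simp only [hO, Finset.sum_const, Finset.card_univ, nsmul_eq_mul]
  simp [P]

/-- Evenness in each coordinate contributes 2^d and the substitution t = 2πu contributes (2π)^{-d};
their product is π^{-d}. This is the form that meets the Fourier side. -/
theorem taikovConst_eq {d m : ℕ} (k : Fin d → ℝ) (r : Fin (m + 1) → Fin d → ℝ)
    (lam : Fin (m + 1) → ℝ) :
    taikovConst k r lam = ⨆ (h : Fin (m + 1) → ℝ) (_ : ∀ j, 0 < h j),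
      ENNReal.ofReal (∏ j, h j ^ lam j) *
        ∫⁻ u : EuclideanSpace ℝ (Fin d), ENNReal.ofReal (powRatio k r h ((2 * Real.pi) • u)) := by
  unfold taikovConst
  simp only [ENNReal.mul_iSup]
  refine iSup_congr fun h => iSup_congr fun _ => ?_
  rw [mul_left_comm]
  congr 1
  rw [lintegral_comp_smul (F := fun t => ENNReal.ofReal (powRatio k r h t)) (by positivity)
      measurable_powRatio.ennreal_ofReal,
    lintegral_eq_two_pow_mul_orthant (F := fun t => ENNReal.ofReal (powRatio k r h t))
      (fun t t' ht => by rw [powRatio_congr_abs ht]), ← mul_assoc]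
  congr 1
  rw [← ENNReal.ofReal_ofNat 2, ← ENNReal.ofReal_pow (by norm_num),
    ← ENNReal.ofReal_mul (by positivity)]
  congr 1
  rw [mul_pow]
  field_simp

/-! ### Weighted Cauchy–Schwarz and the L₂ norms of the derivatives -/

/-- A weighted Cauchy–Schwarz inequality. -/
theorem sq_lintegral_mul_le {α : Type*} [MeasurableSpace α] {μ : Measure α} {a b S : α → ℝ}
    (ha : AEMeasurable a μ) (hb : AEMeasurable b μ) (hS : AEMeasurable S μ)
    (hb0 : ∀ x, 0 ≤ b x) (hS0 : ∀ᵐ x ∂μ, 0 < S x) :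
    (∫⁻ x, ENNReal.ofReal (a x * b x) ∂μ) ^ 2 ≤
      (∫⁻ x, ENNReal.ofReal (a x ^ 2 / S x) ∂μ) * ∫⁻ x, ENNReal.ofReal (S x * b x ^ 2) ∂μ := by
  have key := ENNReal.lintegral_mul_le_Lp_mul_Lq μ Real.HolderConjugate.two_two
    (f := fun x => ENNReal.ofReal (|a x| / √(S x)))
    (g := fun x => ENNReal.ofReal (√(S x) * b x))
    (ha.abs.div hS.sqrt).ennreal_ofReal (hS.sqrt.mul hb).ennreal_ofReal
  have e1 : ∫⁻ x, ENNReal.ofReal (a x * b x) ∂μ ≤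
      ∫⁻ x, ((fun x => ENNReal.ofReal (|a x| / √(S x))) *
        fun x => ENNReal.ofReal (√(S x) * b x)) x ∂μ := by
    refine lintegral_mono_ae ?_
    filter_upwards [hS0] with x hx
    have h := Real.sqrt_pos.2 hx
    rw [Pi.mul_apply, ← ENNReal.ofReal_mul (by positivity)]
    refine ENNReal.ofReal_le_ofReal ?_
    -- The product is split as (|a| / √S) · (√S b), with Hölder exponents 2 and 2.
    have : |a x| / √(S x) * (√(S x) * b x) = |a x| * b x := by field_simp
    rw [this]
    exact mul_le_mul_of_nonneg_right (le_abs_self _) (hb0 x)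
  have e2 : ∫⁻ x, ENNReal.ofReal (|a x| / √(S x)) ^ (2 : ℝ) ∂μ =
      ∫⁻ x, ENNReal.ofReal (a x ^ 2 / S x) ∂μ := by
    refine lintegral_congr_ae ?_
    filter_upwards [hS0] with x hx
    rw [ENNReal.rpow_two, ← ENNReal.ofReal_pow (by positivity), div_pow, sq_abs, Real.sq_sqrt hx.le]
  have e3 : ∫⁻ x, ENNReal.ofReal (√(S x) * b x) ^ (2 : ℝ) ∂μ =
      ∫⁻ x, ENNReal.ofReal (S x * b x ^ 2) ∂μ := by
    refine lintegral_congr_ae ?_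
    filter_upwards [hS0] with x hx
    rw [ENNReal.rpow_two, ← ENNReal.ofReal_pow (mul_nonneg (Real.sqrt_nonneg _) (hb0 x)), mul_pow,
      Real.sq_sqrt hx.le]
  rw [e2, e3] at key
  calc _ ≤ _ := pow_le_pow_left₀ zero_le (e1.trans key) 2
    _ = _ := by
      rw [mul_pow, ← ENNReal.rpow_two, ← ENNReal.rpow_two, ← ENNReal.rpow_mul, ← ENNReal.rpow_mul]
      norm_num

theorem norm_sq_toLp {α : Type*} [MeasurableSpace α] {μ : Measure α} {f : α → ℂ}
    (hf : MemLp f 2 μ) : ‖hf.toLp‖ ^ 2 = ∫ x, ‖f x‖ ^ 2 ∂μ := by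
  rw [← @inner_self_eq_norm_sq ℂ, L2.inner_def]
  have : ∀ᵐ x ∂μ, inner ℂ (hf.toLp f x) (hf.toLp f x) = (((‖f x‖ ^ 2 : ℝ)) : ℂ) := by
    filter_upwards [hf.coeFn_toLp] with x hx
    rw [hx, inner_self_eq_norm_sq_to_K]
    push_cast
    rfl
  rw [integral_congr_ae this]
  exact (congrArg RCLike.re (integral_ofReal (𝕜 := ℂ) (f := fun x => ‖f x‖ ^ 2))).trans
    (RCLike.ofReal_re _)

/-- Each Sobolev condition supplies its own transform of x; uniqueness lets a single g serve all of
them. -/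
theorem HasFourierTransform.memLp_symbol_mul {d : ℕ} {r : Fin d → ℝ}
    {x g : EuclideanSpace ℝ (Fin d) → ℂ} (hx : HasFourierTransform x g) (hr : MemSobolev r x) :
    MemLp (fun u => symbol r u * g u) 2 := by
  obtain ⟨g', hg', hfin⟩ := hr
  have hm : AEStronglyMeasurable (fun u => symbol r u * g u) :=
    (measurable_symbol r).aestronglyMeasurable.mul hx.2.1
  rw [memLp_two_iff_integrable_sq_norm hm]
  refine ⟨hm.norm.pow 2, ?_⟩
  rw [hasFiniteIntegral_iff_ofReal (Eventually.of_forall fun u => by positivity)]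
  refine lt_of_eq_of_lt (lintegral_congr_ae ?_) hfin
  filter_upwards [hx.ae_eq_right hg'] with u hu
  rw [hu, norm_mul, mul_pow, norm_symbol, absPow_two_mul]

theorem IsFracDeriv.hasFourierTransform {d : ℕ} {k : Fin d → ℝ}
    {x y g : EuclideanSpace ℝ (Fin d) → ℂ} (h : IsFracDeriv k x y) (hx : HasFourierTransform x g) :
    HasFourierTransform y (fun u => symbol k u * g u) := by
  obtain ⟨g', hg', hy⟩ := h
  refine hy.congr_right ?_
  filter_upwards [hx.ae_eq_right hg'] with u hu
  rw [hu]

theorem lintegral_powSum_mul_sq {d m : ℕ} {r : Fin (m + 1) → Fin d → ℝ} {h : Fin (m + 1) → ℝ}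
    (hh : ∀ j, 0 < h j) {g : EuclideanSpace ℝ (Fin d) → ℂ}
    (hM : ∀ l, MemLp (fun u => symbol (r l) u * g u) 2) :
    ∫⁻ u, ENNReal.ofReal (powSum r h ((2 * Real.pi) • u) * ‖g u‖ ^ 2) =
      ENNReal.ofReal (∑ l, h l * ‖(hM l).toLp‖ ^ 2) := by
  have e : ∀ u, powSum r h ((2 * Real.pi) • u) * ‖g u‖ ^ 2 =
      ∑ l, h l * ‖symbol (r l) u * g u‖ ^ 2 := fun u => by
    unfold powSum
    rw [Finset.sum_mul]
    refine Finset.sum_congr rfl fun l _ => ?_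
    rw [absPow_two_mul, norm_mul, norm_symbol, mul_pow, mul_assoc]
  have hi : ∀ l ∈ Finset.univ, Integrable (fun u => h l * ‖symbol (r l) u * g u‖ ^ 2) := fun l _ =>
    ((memLp_two_iff_integrable_sq_norm (hM l).1).1 (hM l)).const_mul _
  simp only [e, norm_sq_toLp]
  rw [← ofReal_integral_eq_lintegral_ofReal (integrable_finsetSum _ hi)
    (Eventually.of_forall fun u => Finset.sum_nonneg fun l _ => mul_nonneg (hh l).le (sq_nonneg _)),
    integral_finsetSum _ hi]
  simp only [integral_const_mul]

/-! ### The inequality and the existence of the derivatives -/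

section Inequality

variable {d m : ℕ} {k : Fin d → ℝ} {r : Fin (m + 1) → Fin d → ℝ} {lam : Fin (m + 1) → ℝ}

theorem le_taikovConst {h : Fin (m + 1) → ℝ} (hh : ∀ j, 0 < h j) :
    ENNReal.ofReal (∏ j, h j ^ lam j) *
        ∫⁻ u : EuclideanSpace ℝ (Fin d), ENNReal.ofReal (powRatio k r h ((2 * Real.pi) • u)) ≤
      taikovConst k r lam := by
  rw [taikovConst_eq]
  exact le_iSup₂_of_le h hh le_rfl

theorem two_pi_smul_ne_zero {u : EuclideanSpace ℝ (Fin d)} (hu : ∀ i, u i ≠ 0) (i : Fin d) :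
    ((2 * Real.pi) • u) i ≠ 0 := by
  simpa [Real.pi_ne_zero] using hu i

/-- Cauchy–Schwarz with weight S_h. The parameter h stays free: h = 1 yields integrability, the
optimal h yields the sharp constant. -/
theorem sq_lintegral_norm_symbol_mul_le {h : Fin (m + 1) → ℝ} (hh : ∀ j, 0 < h j)
    {g : EuclideanSpace ℝ (Fin d) → ℂ} (hg : AEStronglyMeasurable g)
    (hM : ∀ l, MemLp (fun u => symbol (r l) u * g u) 2) :
    ENNReal.ofReal (∏ j, h j ^ lam j) * (∫⁻ u, ENNReal.ofReal ‖symbol k u * g u‖) ^ 2 ≤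
      taikovConst k r lam * ENNReal.ofReal (∑ l, h l * ‖(hM l).toLp‖ ^ 2) := by
  have hsm : Measurable fun u : EuclideanSpace ℝ (Fin d) => (2 * Real.pi) • u :=
    measurable_const_smul _
  have h1 := sq_lintegral_mul_le (μ := (volume : Measure (EuclideanSpace ℝ (Fin d))))
    (a := fun u => absPow ((2 * Real.pi) • u) k) (b := fun u => ‖g u‖)
    (S := fun u => powSum r h ((2 * Real.pi) • u))
    ((measurable_absPow k).comp hsm).aemeasurable hg.norm.aemeasurable
    (measurable_powSum.comp hsm).aemeasurable (fun _ => norm_nonneg _)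
    (by filter_upwards [ae_coord_ne_zero] with u hu using powSum_pos hh (two_pi_smul_ne_zero hu))
  rw [lintegral_powSum_mul_sq hh hM] at h1
  simp only [norm_mul, norm_symbol]
  refine (mul_le_mul_right h1 _).trans ?_
  rw [← mul_assoc]
  refine mul_le_mul_left (le_trans (le_of_eq ?_) (le_taikovConst (k := k) (r := r) hh)) _
  simp only [powRatio, absPow_two_mul]

theorem integrable_symbol_mul (hC : taikovConst k r lam ≠ ⊤) {g : EuclideanSpace ℝ (Fin d) → ℂ}
    (hg : AEStronglyMeasurable g) (hM : ∀ l, MemLp (fun u => symbol (r l) u * g u) 2) :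
    Integrable (fun u => symbol k u * g u) := by
  refine ⟨(measurable_symbol k).aestronglyMeasurable.mul hg, ?_⟩
  rw [hasFiniteIntegral_iff_norm]
  have h1 := sq_lintegral_norm_symbol_mul_le (k := k) (lam := lam) (h := fun _ => 1)
    (fun _ => one_pos) hg hM
  simp only [Real.one_rpow, Finset.prod_const_one, ENNReal.ofReal_one, one_mul] at h1
  have h2 := h1.trans_lt (ENNReal.mul_lt_top hC.lt_top ENNReal.ofReal_lt_top)
  by_contra hcon
  rw [not_lt, top_le_iff] at hcon
  rw [hcon] at h2
  simp at h2

theorem integral_norm_symbol_mul_le (hlam : ∀ j, 0 < lam j) (hsum : ∑ j, lam j = 1)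
    (hC : taikovConst k r lam ≠ ⊤) {g : EuclideanSpace ℝ (Fin d) → ℂ}
    (hg : AEStronglyMeasurable g) (hM : ∀ l, MemLp (fun u => symbol (r l) u * g u) 2) :
    ∫ u, ‖symbol k u * g u‖ ≤
      √((taikovConst k r lam).toReal * ∏ j, lam j ^ (-lam j)) *
        ∏ j, ‖(hM j).toLp‖ ^ lam j := by
  have hrhs : 0 ≤ √((taikovConst k r lam).toReal * ∏ j, lam j ^ (-lam j)) *
        ∏ j, ‖(hM j).toLp‖ ^ lam j :=
    mul_nonneg (Real.sqrt_nonneg _) (Finset.prod_nonneg fun j _ =>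
      Real.rpow_nonneg (norm_nonneg _) _)
  -- If some norm vanishes the optimal h is undefined, but then g = 0 almost everywhere because
  -- symbols do not vanish off the coordinate hyperplanes.
  by_cases hz : ∃ l, ‖(hM l).toLp‖ = 0
  · obtain ⟨l, hl⟩ := hz
    have hz' : (fun u => symbol (r l) u * g u) =ᵐ[volume] 0 :=
      (hM l).coeFn_toLp.symm.trans (by
        rw [norm_eq_zero] at hl
        rw [hl]
        exact Lp.coeFn_zero _ _ _)
    have : (fun u => ‖symbol k u * g u‖) =ᵐ[volume] fun _ => (0 : ℝ) := by
      filter_upwards [hz', ae_coord_ne_zero] with u hu hu'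
      have : g u = 0 := (mul_eq_zero.1 hu).resolve_left (symbol_ne_zero _ hu')
      simp [this]
    rw [integral_congr_ae this]
    simpa using hrhs
  push Not at hz
  have hN : ∀ l, 0 < ‖(hM l).toLp‖ := fun l => lt_of_le_of_ne (norm_nonneg _) (hz l).symm
  set N : Fin (m + 1) → ℝ := fun l => ‖(hM l).toLp‖ with hNdef
  -- This h makes ∑ h_l N_l² = 1 and all the quotients h_j N_j² / λ_j equal, the equality case of
  -- the weighted AM–GM inequality.
  have hh : ∀ j, 0 < lam j / N j ^ 2 := fun j => div_pos (hlam j) (pow_pos (hN j) 2)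
  have h1 := sq_lintegral_norm_symbol_mul_le (k := k) (lam := lam) hh hg hM
  have hs : ∑ l, lam l / N l ^ 2 * ‖(hM l).toLp‖ ^ 2 = 1 := by
    rw [← hsum]
    refine Finset.sum_congr rfl fun l _ => ?_
    exact div_mul_cancel₀ _ (pow_pos (hN l) 2).ne'
  have hI := integrable_symbol_mul hC hg hM
  rw [hs, ENNReal.ofReal_one, mul_one,
    ← ofReal_integral_eq_lintegral_ofReal hI.norm (Eventually.of_forall fun _ => norm_nonneg _),
    ← ENNReal.ofReal_pow (integral_nonneg fun _ => norm_nonneg _),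
    ← ENNReal.ofReal_mul (Finset.prod_nonneg fun j _ => Real.rpow_nonneg (hh j).le _),
    ENNReal.ofReal_le_iff_le_toReal hC] at h1
  have hp : ∏ j, (lam j / N j ^ 2) ^ lam j =
      (∏ j, lam j ^ (-lam j))⁻¹ * ((∏ j, N j ^ lam j) ^ 2)⁻¹ := by
    rw [← Finset.prod_pow, ← Finset.prod_inv_distrib, ← Finset.prod_inv_distrib,
      ← Finset.prod_mul_distrib]
    refine Finset.prod_congr rfl fun j _ => ?_
    rw [Real.div_rpow (hlam j).le (sq_nonneg _), Real.rpow_neg (hlam j).le, inv_inv, div_eq_mul_inv,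
      ← Real.rpow_natCast_mul (hN j).le, ← Real.rpow_mul_natCast (hN j).le, mul_comm (lam j)]
  have hA : 0 < ∏ j, lam j ^ (-lam j) := Finset.prod_pos fun j _ => Real.rpow_pos_of_pos (hlam j) _
  have hB : 0 < ∏ j, N j ^ lam j := Finset.prod_pos fun j _ => Real.rpow_pos_of_pos (hN j) _
  rw [hp] at h1
  refine (sq_le_sq₀ (integral_nonneg fun _ => norm_nonneg _) hrhs).1 ?_
  rw [mul_pow, Real.sq_sqrt (mul_nonneg ENNReal.toReal_nonneg hA.le)]
  change _ ≤ _ * (∏ j, N j ^ lam j) ^ 2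
  have h2 := mul_le_mul_of_nonneg_right h1
    (mul_nonneg hA.le (sq_nonneg (∏ j, N j ^ lam j)))
  calc _ = _ := ?_
    _ ≤ _ := h2
    _ = _ := by ring
  field_simp

theorem isFracDeriv_fourierInvBCF {x g : EuclideanSpace ℝ (Fin d) → ℂ}
    (hx : HasFourierTransform x g) (hI : Integrable fun u => symbol k u * g u) :
    IsFracDeriv k x (fourierInvBCF _ hI) :=
  ⟨g, hx, hasFourierTransform_fourierInv hI⟩

/-- Equal transforms force equality almost everywhere, and continuous functions that agree almost
everywhere agree. -/
theorem IsFracDeriv.eq_fourierInvBCF {x g : EuclideanSpace ℝ (Fin d) → ℂ}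
    (hx : HasFourierTransform x g) (hI : Integrable fun u => symbol k u * g u)
    {y : EuclideanSpace ℝ (Fin d) →ᵇ ℂ} (hy : IsFracDeriv k x y) : y = fourierInvBCF _ hI := by
  have h := (hy.hasFourierTransform hx).ae_eq_left
    ((isFracDeriv_fourierInvBCF hx hI).hasFourierTransform hx) (ae_eq_refl _)
  exact DFunLike.coe_injective (Continuous.ae_eq_iff_eq volume y.continuous
    (fourierInvBCF _ hI).continuous |>.1 h)

theorem isFracDeriv_fourierInv_toLp {x g : EuclideanSpace ℝ (Fin d) → ℂ}
    (hx : HasFourierTransform x g) (hM : MemLp (fun u => symbol k u * g u) 2) :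
    IsFracDeriv k x
      (𝓕⁻ hM.toLp : Lp ℂ 2 (volume : Measure (EuclideanSpace ℝ (Fin d)))) :=
  ⟨g, hx, (hasFourierTransform_fourierInv_Lp _).congr_right hM.coeFn_toLp⟩

theorem IsFracDeriv.eq_fourierInv_toLp {x g : EuclideanSpace ℝ (Fin d) → ℂ}
    (hx : HasFourierTransform x g) (hM : MemLp (fun u => symbol k u * g u) 2)
    {z : Lp ℂ 2 (volume : Measure (EuclideanSpace ℝ (Fin d)))} (hz : IsFracDeriv k x z) :
    z = 𝓕⁻ hM.toLp :=
  Lp.ext ((hz.hasFourierTransform hx).ae_eq_left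
    ((isFracDeriv_fourierInv_toLp hx hM).hasFourierTransform hx) (ae_eq_refl _))

theorem existsUnique_isFracDeriv (hC : taikovConst k r lam ≠ ⊤)
    {x : EuclideanSpace ℝ (Fin d) → ℂ} (hx : ∀ l, MemSobolev (r l) x) :
    (∃! y : EuclideanSpace ℝ (Fin d) →ᵇ ℂ, IsFracDeriv k x y) ∧
      ∀ l, ∃! z : Lp ℂ 2 (volume : Measure (EuclideanSpace ℝ (Fin d))), IsFracDeriv (r l) x z := by
  obtain ⟨g, hg, -⟩ := hx 0
  have hM := fun l => hg.memLp_symbol_mul (hx l)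
  have hI := integrable_symbol_mul hC hg.2.1 hM
  exact ⟨⟨_, isFracDeriv_fourierInvBCF hg hI, fun y hy => hy.eq_fourierInvBCF hg hI⟩,
    fun l => ⟨_, isFracDeriv_fourierInv_toLp hg (hM l),
      fun z hz => hz.eq_fourierInv_toLp hg (hM l)⟩⟩

theorem norm_fracDeriv_le (hlam : ∀ j, 0 < lam j) (hsum : ∑ j, lam j = 1)
    (hC : taikovConst k r lam ≠ ⊤) {x : EuclideanSpace ℝ (Fin d) → ℂ}
    (hx : ∀ l, MemSobolev (r l) x) {y : EuclideanSpace ℝ (Fin d) →ᵇ ℂ}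
    {z : Fin (m + 1) → Lp ℂ 2 (volume : Measure (EuclideanSpace ℝ (Fin d)))}
    (hy : IsFracDeriv k x y) (hz : ∀ l, IsFracDeriv (r l) x (z l)) :
    ‖y‖ ≤ √((taikovConst k r lam).toReal * ∏ j, lam j ^ (-lam j)) * ∏ j, ‖z j‖ ^ lam j := by
  obtain ⟨g, hg, -⟩ := hx 0
  have hM := fun l => hg.memLp_symbol_mul (hx l)
  have hI := integrable_symbol_mul hC hg.2.1 hM
  have hzn : ∀ l, ‖z l‖ = ‖(hM l).toLp‖ := fun l => by
    rw [(hz l).eq_fourierInv_toLp hg (hM l), norm_fourierInv_Lp]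
  rw [hy.eq_fourierInvBCF hg hI]
  simp only [hzn]
  exact (norm_fourierInvBCF_le _ hI).trans (integral_norm_symbol_mul_le hlam hsum hC hg.2.1 hM)

end Inequality

/-! ### Finiteness of the constant -/

section Finiteness

variable {d m : ℕ} {k : Fin d → ℝ} {r : Fin (m + 1) → Fin d → ℝ} {lam : Fin (m + 1) → ℝ}

/-- Otherwise all the points, hence their hull, lie in the hyperplane through p orthogonal to x,
while p + t x remains in the hull for small t > 0 and leaves the hyperplane. -/
theorem eq_zero_of_orthogonal_of_mem_interior {ι : Type*} {r : ι → Fin d → ℝ} {p x : Fin d → ℝ}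
    (hp : p ∈ interior (convexHull ℝ (Set.range r))) (hx : ∀ l, ∑ i, (r l i - p i) * x i = 0) :
    x = 0 := by
  have hsub : convexHull ℝ (Set.range r) ⊆ {y : Fin d → ℝ | ∑ i, y i * x i = ∑ i, p i * x i} := by
    refine convexHull_min ?_ (convex_hyperplane (𝕜 := ℝ) (f := fun y : Fin d → ℝ => ∑ i, y i * x i)
      ⟨fun y z => by simp [add_mul, Finset.sum_add_distrib],
        fun c y => by simp [Finset.mul_sum, mul_assoc]⟩ _)
    rintro _ ⟨l, rfl⟩
    have := hx l
    simp only [sub_mul, Finset.sum_sub_distrib] at this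
    exact sub_eq_zero.1 this
  have hc : Tendsto (fun t : ℝ => p + t • x) (𝓝[>] 0) (𝓝 p) := by
    have : Continuous fun t : ℝ => p + t • x := by fun_prop
    have h := this.tendsto 0
    simp only [zero_smul, add_zero] at h
    exact h.mono_left nhdsWithin_le_nhds
  obtain ⟨t, ht, ht0⟩ := ((hc.eventually (mem_interior_iff_mem_nhds.1 hp)).and
    self_mem_nhdsWithin).exists
  have h1 : ∑ i, (p + t • x) i * x i = ∑ i, p i * x i := hsub ht
  simp only [Pi.add_apply, Pi.smul_apply, smul_eq_mul, add_mul, Finset.sum_add_distrib,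
    add_eq_left, mul_assoc, ← Finset.mul_sum] at h1
  have h2 := (mul_eq_zero.1 h1).resolve_left (ne_of_gt ht0)
  funext i
  exact mul_self_eq_zero.1
    ((Finset.sum_eq_zero_iff_of_nonneg fun i _ => mul_self_nonneg (x i)).1 h2 i (Finset.mem_univ i))

/-- Affine functions whose linear parts have the origin in the interior of their convex hull: the
maximum exceeds the weighted mean by a multiple of the distance to a suitable centre, with a
constant that does not depend on the constant terms. -/
theorem exists_affine_max_lower_bound (hlam : ∀ j, 0 < lam j) (hsum : ∑ j, lam j = 1)
    (hk_int : (fun i => ∑ j, lam j * r j i) ∈ interior (convexHull ℝ (Set.range r))) :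
    ∃ c > 0, ∀ a : Fin (m + 1) → ℝ, ∃ x₀ : Fin d → ℝ, ∀ x : Fin d → ℝ, ∃ l,
      ∑ j, lam j * (a j + 2 * ∑ i, r j i * x i) - (a l + 2 * ∑ i, r l i * x i) ≤
        -(c * ∑ i, |x i - x₀ i|) := by
  set p : Fin d → ℝ := fun i => ∑ j, lam j * r j i with hp
  -- R records the deviations of the linear parts from their mean. It is injective by the interior
  -- condition, so a bounded left inverse L controls x by its deviations.
  let R : (Fin d → ℝ) →ₗ[ℝ] (Fin (m + 1) → ℝ) :=
    { toFun := fun x l => 2 * ∑ i, (r l i - p i) * x i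
      map_add' := fun x y => by
        funext l; simp [mul_add, Finset.sum_add_distrib]
      map_smul' := fun c x => by
        funext l
        simp only [Pi.smul_apply, smul_eq_mul, Finset.mul_sum, RingHom.id_apply]
        exact Finset.sum_congr rfl fun i _ => by ring }
  have hR : R.ker = ⊥ := by
    rw [LinearMap.ker_eq_bot']
    intro x hx
    refine eq_zero_of_orthogonal_of_mem_interior hk_int fun l => ?_
    have : 2 * ∑ i, (r l i - p i) * x i = 0 := congrFun hx l
    linarith
  obtain ⟨L, hL⟩ := LinearMap.exists_leftInverse_of_injective R hR
  obtain ⟨B, hB0, hB⟩ : ∃ B > 0, ∀ v, ‖L v‖ ≤ B * ‖v‖ :=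
    L.toContinuousLinearMap.isBoundedLinearMap.bound
  obtain ⟨j₀, hj₀⟩ := Finite.exists_min lam
  -- The smallest weight λ_{j₀} compares ‖v‖ with max v, B bounds L, and d + 1 passes from the sup
  -- norm to the sum of coordinates (staying nonzero for every d).
  have hc : 0 < lam j₀ / ((d + 1) * B) := div_pos (hlam j₀) (by positivity)
  -- The centre is chosen so that L v = x - x₀, where v is the vector of deviations from the λ-mean.
  refine ⟨_, hc, fun a => ⟨-L (fun l => a l - ∑ j, lam j * a j), fun x => ?_⟩⟩
  set v : Fin (m + 1) → ℝ := (fun l => a l - ∑ j, lam j * a j) + R x with hv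
  have hvl : ∀ l, v l = (a l + 2 * ∑ i, r l i * x i) -
      ∑ j, lam j * (a j + 2 * ∑ i, r j i * x i) := by
    intro l
    have e : ∑ i, p i * x i = ∑ j, lam j * ∑ i, r j i * x i := by
      simp only [hp, Finset.sum_mul, Finset.mul_sum]
      rw [Finset.sum_comm]
      exact Finset.sum_congr rfl fun j _ => Finset.sum_congr rfl fun i _ => by ring
    have e2 : ∑ j, lam j * (a j + 2 * ∑ i, r j i * x i) =
        ∑ j, lam j * a j + 2 * ∑ i, p i * x i := by
      rw [e, Finset.mul_sum, ← Finset.sum_add_distrib]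
      exact Finset.sum_congr rfl fun j _ => by ring
    rw [e2]
    simp only [hv, R, Pi.add_apply, LinearMap.coe_mk, AddHom.coe_mk, sub_mul,
      Finset.sum_sub_distrib]
    ring
  have hmean : ∑ l, lam l * v l = 0 := by
    simp only [hvl, mul_sub, Finset.sum_sub_distrib, ← Finset.sum_mul, hsum, one_mul, sub_self]
  obtain ⟨l, hl⟩ := Finite.exists_max v
  refine ⟨l, ?_⟩
  have hD0 : 0 ≤ v l := by
    have : ∑ j, lam j * v j ≤ ∑ j, lam j * v l :=
      Finset.sum_le_sum fun j _ => mul_le_mul_of_nonneg_left (hl j) (hlam j).le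
    rwa [hmean, ← Finset.sum_mul, hsum, one_mul] at this
  have hvn : ‖v‖ ≤ v l / lam j₀ := by
    rw [pi_norm_le_iff_of_nonneg (div_nonneg hD0 (hlam j₀).le)]
    intro j
    rw [Real.norm_eq_abs, le_div_iff₀ (hlam j₀)]
    refine (mul_le_mul_of_nonneg_left (hj₀ j) (abs_nonneg _)).trans ?_
    have hs := Finset.add_sum_erase Finset.univ (fun i => lam i * v i) (Finset.mem_univ j)
    have hs' := Finset.add_sum_erase Finset.univ lam (Finset.mem_univ j)
    have hle : ∑ i ∈ Finset.univ.erase j, lam i * v i ≤ ∑ i ∈ Finset.univ.erase j, lam i * v l :=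
      Finset.sum_le_sum fun i _ => mul_le_mul_of_nonneg_left (hl i) (hlam i).le
    have hr : 0 ≤ ∑ i ∈ Finset.univ.erase j, lam i := Finset.sum_nonneg fun i _ => (hlam i).le
    rw [← Finset.sum_mul] at hle
    rw [hmean] at hs
    rw [hsum] at hs'
    have hj1 : lam j ≤ 1 := by linarith
    have hlj := hlam j
    have hvj := hl j
    -- Since ∑ λ_i v_i = 0, a negative v_j satisfies λ_j |v_j| ≤ (1 - λ_j) max v.
    rcases abs_cases (v j) with ⟨h, h0⟩ | ⟨h, h0⟩ <;> rw [h] <;> nlinarith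
  have hx : x - -L (fun l => a l - ∑ j, lam j * a j) = L v := by
    have : L (R x) = x := LinearMap.congr_fun hL x
    rw [hv, map_add, this]
    abel
  have hcoord : ∑ i, |x i - (-L (fun l => a l - ∑ j, lam j * a j)) i| ≤ (d + 1) * ‖L v‖ := by
    calc _ ≤ ∑ _i : Fin d, ‖L v‖ := Finset.sum_le_sum fun i _ => by
          rw [← hx]
          exact norm_le_pi_norm (x - -L (fun l => a l - ∑ j, lam j * a j)) i
      _ ≤ _ := by
        simp only [Finset.sum_const, Finset.card_univ, Fintype.card_fin, nsmul_eq_mul]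
        exact mul_le_mul_of_nonneg_right (by linarith) (norm_nonneg _)
  rw [show ∑ j, lam j * (a j + 2 * ∑ i, r j i * x i) - (a l + 2 * ∑ i, r l i * x i) = - v l by
    rw [hvl]; ring, neg_le_neg_iff]
  calc _ ≤ lam j₀ / ((d + 1) * B) * ((d + 1) * (B * (v l / lam j₀))) := by
        refine mul_le_mul_of_nonneg_left (hcoord.trans ?_) hc.le
        refine mul_le_mul_of_nonneg_left ((hB v).trans ?_) (by positivity)
        exact mul_le_mul_of_nonneg_left hvn hB0.le
    _ = v l := by
      have := hlam j₀
      field_simp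

theorem integrable_exp_neg_mul_abs {c : ℝ} (hc : 0 < c) :
    Integrable fun x : ℝ => Real.exp (-(c * |x|)) := by
  rw [← integrableOn_univ, ← Set.Iic_union_Ioi (a := (0 : ℝ))]
  refine IntegrableOn.union ?_ ?_
  · refine (integrableOn_exp_mul_Iic hc 0).congr_fun (fun x hx => ?_) measurableSet_Iic
    simp only [abs_of_nonpos (Set.mem_Iic.1 hx), mul_neg, neg_neg]
  · refine (integrableOn_exp_mul_Ioi (neg_lt_zero.2 hc) 0).congr_fun (fun x hx => ?_)
      measurableSet_Ioi
    simp only [abs_of_pos (Set.mem_Ioi.1 hx), neg_mul]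

/-- `t⁻¹ exp (-c |log t - b|)` on the positive half line. -/
def logExp (c b : ℝ) : ℝ → ℝ :=
  (Set.Ioi 0).indicator fun t => t⁻¹ * Real.exp (-(c * |Real.log t - b|))

theorem logExp_nonneg (c b t : ℝ) : 0 ≤ logExp c b t :=
  Set.indicator_nonneg (fun _ ht => mul_nonneg (inv_nonneg.2 (le_of_lt ht)) (Real.exp_nonneg _)) _

theorem integrable_logExp {c : ℝ} (hc : 0 < c) (b : ℝ) : Integrable (logExp c b) := by
  rw [logExp, integrable_indicator_iff measurableSet_Ioi, ← Real.range_exp, ← Set.image_univ,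
    integrableOn_image_iff_integrableOn_abs_deriv_smul MeasurableSet.univ
      (fun x _ => (Real.hasDerivAt_exp x).hasDerivWithinAt) Real.exp_injective.injOn,
    integrableOn_univ]
  refine ((integrable_exp_neg_mul_abs hc).comp_sub_right b).congr
    (Eventually.of_forall fun x => ?_)
  simp [abs_of_pos (Real.exp_pos x)]

/-- The substitution t = e^x and a translation remove b, which makes the bound on the constant
uniform in h. -/
theorem integral_logExp (c b : ℝ) : ∫ t, logExp c b t = ∫ x, Real.exp (-(c * |x|)) := by
  rw [logExp, integral_indicator measurableSet_Ioi, ← Real.range_exp, ← Set.image_univ,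
    integral_image_eq_integral_abs_deriv_smul MeasurableSet.univ
      (fun x _ => (Real.hasDerivAt_exp x).hasDerivWithinAt) Real.exp_injective.injOn,
    Measure.restrict_univ, ← integral_sub_right_eq_self (fun x => Real.exp (-(c * |x|))) b]
  refine integral_congr_ae (Eventually.of_forall fun x => ?_)
  simp [abs_of_pos (Real.exp_pos x)]

theorem lintegral_prod_logExp {c : ℝ} (hc : 0 < c) (b : Fin d → ℝ) :
    ∫⁻ t : EuclideanSpace ℝ (Fin d), ENNReal.ofReal (∏ i, logExp c (b i) (t i)) =
      ENNReal.ofReal ((∫ x, Real.exp (-(c * |x|))) ^ d) := by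
  have hi : Integrable fun t : Fin d → ℝ => ∏ i, logExp c (b i) (t i) :=
    Integrable.fintype_prod fun i => integrable_logExp hc (b i)
  have h1 := (EuclideanSpace.volume_preserving_symm_measurableEquiv_toLp
    (Fin d)).lintegral_comp_emb (MeasurableEquiv.measurableEmbedding _)
      (fun t => ENNReal.ofReal (∏ i, logExp c (b i) (t i)))
  refine h1.trans ?_
  rw [← ofReal_integral_eq_lintegral_ofReal hi
    (Eventually.of_forall fun t => Finset.prod_nonneg fun i _ => logExp_nonneg _ _ _),
    integral_fintype_prod_volume_eq_prod]
  simp [integral_logExp]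

theorem absPow_eq_exp {t : EuclideanSpace ℝ (Fin d)} (ht : ∀ i, 0 < t i) (s : Fin d → ℝ) :
    absPow t s = Real.exp (∑ i, s i * Real.log (t i)) := by
  unfold absPow
  rw [Real.exp_sum]
  refine Finset.prod_congr rfl fun i _ => ?_
  rw [abs_of_pos (ht i), Real.rpow_def_of_pos (ht i), mul_comm]

/-- Keeping only the largest term of the denominator bounds the integrand, multiplied by ∏
h_j^{λ_j}, by a product of functions `logExp` centred at a point depending on h; their integral does
not depend on the centre. -/
theorem taikovConst_ne_top (hlam : ∀ j, 0 < lam j) (hsum : ∑ j, lam j = 1)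
    (hk : ∀ i, k i + 1 / 2 = ∑ j, lam j * r j i)
    (hk_int : (fun i => k i + 1 / 2) ∈ interior (convexHull ℝ (Set.range r))) :
    taikovConst k r lam ≠ ⊤ := by
  rw [funext hk] at hk_int
  obtain ⟨c, hc, hbound⟩ := exists_affine_max_lower_bound hlam hsum hk_int
  have hP : MeasurableSet {t : EuclideanSpace ℝ (Fin d) | ∀ i, 0 < t i} := by
    simp only [Set.ofPred_forall]
    exact MeasurableSet.iInter fun i => measurableSet_lt measurable_const (by fun_prop)
  refine ne_top_of_le_ne_top (b := ENNReal.ofReal ((Real.pi ^ d)⁻¹) *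
    ENNReal.ofReal ((∫ x, Real.exp (-(c * |x|))) ^ d))
    (ENNReal.mul_ne_top ENNReal.ofReal_ne_top ENNReal.ofReal_ne_top) ?_
  refine mul_le_mul_right (iSup₂_le fun h hh => ?_) _
  obtain ⟨x₀, hx₀⟩ := hbound fun j => Real.log (h j)
  have hH : 0 ≤ ∏ j, h j ^ lam j := Finset.prod_nonneg fun j _ => Real.rpow_nonneg (hh j).le _
  change _ * ∫⁻ t in {t : EuclideanSpace ℝ (Fin d) | ∀ i, 0 < t i},
    ENNReal.ofReal (powRatio k r h t) ≤ _
  rw [← lintegral_const_mul _ (measurable_powRatio (k := k) (r := r) (h := h)).ennreal_ofReal,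
    ← lintegral_prod_logExp hc x₀]
  refine le_trans (setLIntegral_mono' hP fun t ht => ?_) (setLIntegral_le_lintegral _ _)
  rw [← ENNReal.ofReal_mul hH]
  refine ENNReal.ofReal_le_ofReal ?_
  obtain ⟨l, hl⟩ := hx₀ fun i => Real.log (t i)
  have hprod : ∏ j, h j ^ lam j = Real.exp (∑ j, lam j * Real.log (h j)) := by
    rw [Real.exp_sum]
    refine Finset.prod_congr rfl fun j _ => ?_
    rw [Real.rpow_def_of_pos (hh j), mul_comm]
  have hinv : ∏ i, (t i)⁻¹ = Real.exp (-∑ i, Real.log (t i)) := by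
    rw [← Finset.sum_neg_distrib, Real.exp_sum]
    refine Finset.prod_congr rfl fun i _ => ?_
    rw [← Real.log_inv, Real.exp_log (inv_pos.2 (ht i))]
  have hR : ∏ i, logExp c (x₀ i) (t i) =
      Real.exp (-∑ i, Real.log (t i)) * Real.exp (-(c * ∑ i, |Real.log (t i) - x₀ i|)) := by
    rw [← hinv, Finset.mul_sum, ← Finset.sum_neg_distrib, Real.exp_sum, ← Finset.prod_mul_distrib]
    exact Finset.prod_congr rfl fun i _ => Set.indicator_of_mem (Set.mem_Ioi.2 (ht i)) _
  have hterm : h l * absPow t (fun i => 2 * r l i) =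
      Real.exp (Real.log (h l) + 2 * ∑ i, r l i * Real.log (t i)) := by
    rw [absPow_eq_exp ht, Real.exp_add, Real.exp_log (hh l), Finset.mul_sum]
    simp only [mul_assoc]
  have hsum_ge : Real.exp (Real.log (h l) + 2 * ∑ i, r l i * Real.log (t i)) ≤
      ∑ l, h l * absPow t (fun i => 2 * r l i) := by
    rw [← hterm]
    exact Finset.single_le_sum (f := fun l => h l * absPow t (fun i => 2 * r l i))
      (fun l _ => mul_nonneg (hh l).le (absPow_nonneg _ _)) (Finset.mem_univ l)
  -- From 2k = -1 + 2 ∑ λ_j r^j: the -1 is the Jacobian of the logarithm, and the rest is the λ-mean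
  -- of the affine functions without their constant terms.
  have hexp : ∑ i, 2 * k i * Real.log (t i) = -∑ i, Real.log (t i) +
      (∑ j, lam j * (Real.log (h j) + 2 * ∑ i, r j i * Real.log (t i)) -
        ∑ j, lam j * Real.log (h j)) := by
    have e : ∀ i, 2 * k i * Real.log (t i) =
        - Real.log (t i) + 2 * ∑ j, lam j * (r j i * Real.log (t i)) := fun i => by
      have e' : ∑ j, lam j * (r j i * Real.log (t i)) = (k i + 1 / 2) * Real.log (t i) := by
        rw [hk i, Finset.sum_mul]
        exact Finset.sum_congr rfl fun j _ => by ring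
      rw [e']
      ring
    simp only [e, Finset.sum_add_distrib, Finset.sum_neg_distrib, mul_add, add_sub_cancel_left,
      ← Finset.mul_sum]
    rw [Finset.sum_comm]
    simp only [Finset.mul_sum]
    congr 1
    exact Finset.sum_congr rfl fun j _ => Finset.sum_congr rfl fun i _ => by ring
  calc (∏ j, h j ^ lam j) * (absPow t (fun i => 2 * k i) /
        ∑ l, h l * absPow t (fun i => 2 * r l i))
      ≤ (∏ j, h j ^ lam j) * (absPow t (fun i => 2 * k i) /
        Real.exp (Real.log (h l) + 2 * ∑ i, r l i * Real.log (t i))) :=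
        mul_le_mul_of_nonneg_left (div_le_div_of_nonneg_left (absPow_nonneg _ _)
          (Real.exp_pos _) hsum_ge) hH
    _ ≤ _ := by
      rw [hR, hprod, absPow_eq_exp ht, hexp, ← Real.exp_sub, ← Real.exp_add, ← Real.exp_add,
        Real.exp_le_exp]
      linarith

end Finiteness

/-! ### Unit cubes about integer points -/

section UnitCube

variable {d : ℕ}

theorem unitCube_eq_preimage (n : Fin d → ℤ) :
    unitCube n = (EuclideanSpace.equiv (Fin d) ℝ).toHomeomorph ⁻¹'
      Set.pi Set.univ fun i => Set.Icc ((n i : ℝ) - 1 / 2) (n i + 1 / 2) := by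
  ext t
  simp only [unitCube, Set.mem_preimage, Set.mem_univ_pi, Set.mem_Icc]
  change (∀ i, |t i - n i| ≤ 1 / 2) ↔ ∀ i, (n i : ℝ) - 1 / 2 ≤ t i ∧ t i ≤ n i + 1 / 2
  refine forall_congr' fun i => ?_
  rw [abs_le]
  constructor <;> rintro ⟨h1, h2⟩ <;> constructor <;> linarith

theorem isCompact_unitCube (n : Fin d → ℤ) : IsCompact (unitCube n) := by
  rw [unitCube_eq_preimage, Homeomorph.isCompact_preimage]
  exact isCompact_univ_pi fun i => isCompact_Icc

theorem measurableSet_unitCube (n : Fin d → ℤ) : MeasurableSet (unitCube n) :=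
  (isCompact_unitCube n).isClosed.measurableSet

theorem volume_unitCube (n : Fin d → ℤ) : volume (unitCube n) = 1 := by
  have h := (EuclideanSpace.volume_preserving_symm_measurableEquiv_toLp
    (Fin d)).measure_preimage (s := Set.pi Set.univ fun i =>
      Set.Icc ((n i : ℝ) - 1 / 2) (n i + 1 / 2))
    (MeasurableSet.univ_pi fun i => measurableSet_Icc).nullMeasurableSet
  rw [unitCube_eq_preimage]
  refine h.trans ?_
  rw [volume_pi_pi]
  refine Finset.prod_eq_one fun i _ => ?_
  rw [Real.volume_Icc]
  norm_num

theorem aedisjoint_unitCube {n n' : Fin d → ℤ} (h : n ≠ n') :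
    AEDisjoint volume (unitCube n) (unitCube n') := by
  obtain ⟨i, hi⟩ := Function.ne_iff.1 h
  -- Distinct closed cubes meet at most in a common face, where the i-th coordinate is the midpoint
  -- of n_i and n'_i.
  refine measure_mono_null ?_ (volume_coord_eq i (((n i : ℝ) + n' i) / 2))
  rintro t ⟨h1, h2⟩
  have h1 := abs_le.1 (h1 i)
  have h2 := abs_le.1 (h2 i)
  change t i = _
  rcases lt_or_gt_of_ne hi with h3 | h3
  · have : (n i : ℝ) + 1 ≤ n' i := by exact_mod_cast h3
    linarith
  · have : (n' i : ℝ) + 1 ≤ n i := by exact_mod_cast h3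
    linarith

theorem ne_zero_of_mem_unitCube {n : Fin d → ℤ} (hn : ∀ i, n i ≠ 0) {t : EuclideanSpace ℝ (Fin d)}
    (ht : t ∈ unitCube n) (i : Fin d) : t i ≠ 0 := by
  intro h0
  have h1 := abs_le.1 (ht i)
  rw [h0] at h1
  rcases lt_or_gt_of_ne (hn i) with h3 | h3
  · have : (n i : ℝ) + 1 ≤ 0 := by exact_mod_cast h3
    linarith
  · have : (1 : ℝ) ≤ n i := by exact_mod_cast h3
    linarith

theorem integrableOn_absPow_unitCube {n : Fin d → ℤ} (hn : ∀ i, n i ≠ 0) {c : ℝ} (hc : c ≠ 0)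
    (s : Fin d → ℝ) : IntegrableOn (fun t => absPow (c • t) s) (unitCube n) := by
  refine ContinuousOn.integrableOn_compact (isCompact_unitCube n) fun t ht => ?_
  refine ContinuousAt.continuousWithinAt ?_
  have h1 : ContinuousAt (fun u => absPow u s) (c • t) :=
    continuousAt_absPow (fun i => by simpa [hc] using ne_zero_of_mem_unitCube hn ht i) s
  exact ContinuousAt.comp (f := fun t : EuclideanSpace ℝ (Fin d) => c • t) h1
    (continuous_const_smul c).continuousAt

end UnitCube

/-! ### The mesh formula -/

section Mesh

variable {d m : ℕ} {k : Fin d → ℝ} {r : Fin (m + 1) → Fin d → ℝ} {lam : Fin (m + 1) → ℝ}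

theorem measurable_powRatio_smul {h : Fin (m + 1) → ℝ} (c : ℝ) :
    Measurable fun u : EuclideanSpace ℝ (Fin d) => powRatio k r h (c • u) :=
  measurable_powRatio.comp (measurable_const_smul c)

/-- The summand of the mesh constant without the factor `ρ^d`. -/
def meshTerm (k : Fin d → ℝ) (r : Fin (m + 1) → Fin d → ℝ) (h : Fin (m + 1) → ℝ) (ρ : ℝ)
    (n : Fin d → ℤ) : ℝ :=
  (∫ t in unitCube n, absPow ((2 * Real.pi * ρ) • t) k) ^ 2 /
    ∑ l, h l * ∫ t in unitCube n, absPow ((2 * Real.pi * ρ) • t) (fun i => 2 * r l i)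

/-- Cauchy–Schwarz on the cube with weight S_h and b = 1, divided by the integral of S_h. -/
theorem ofReal_meshTerm_le {h : Fin (m + 1) → ℝ} (hh : ∀ j, 0 < h j) {ρ : ℝ} (hρ : 0 < ρ)
    {n : Fin d → ℤ} (hn : ∀ i, n i ≠ 0) :
    ENNReal.ofReal (meshTerm k r h ρ n) ≤
      ∫⁻ t in unitCube n, ENNReal.ofReal (powRatio k r h ((2 * Real.pi) • (ρ • t))) := by
  have hc : 2 * Real.pi * ρ ≠ 0 := by positivity
  set D : ℝ := ∑ l, h l * ∫ t in unitCube n, absPow ((2 * Real.pi * ρ) • t) (fun i => 2 * r l i)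
    with hD
  have hD0 : 0 ≤ D := Finset.sum_nonneg fun l _ => mul_nonneg (hh l).le
    (integral_nonneg fun t => absPow_nonneg _ _)
  rcases hD0.eq_or_lt with h0 | hDpos
  · rw [meshTerm, ← hD, ← h0, div_zero, ENNReal.ofReal_zero]
    exact zero_le
  have hsm : Measurable fun u : EuclideanSpace ℝ (Fin d) => (2 * Real.pi * ρ) • u :=
    measurable_const_smul _
  have key := sq_lintegral_mul_le (μ := volume.restrict (unitCube n))
    (a := fun t => absPow ((2 * Real.pi * ρ) • t) k) (b := fun _ => 1)
    (S := fun t => powSum r h ((2 * Real.pi * ρ) • t))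
    ((measurable_absPow k).comp hsm).aemeasurable aemeasurable_const
    (measurable_powSum.comp hsm).aemeasurable (fun _ => zero_le_one)
    (ae_restrict_of_forall_mem (measurableSet_unitCube n) fun t ht =>
      powSum_pos hh fun i => by
        rw [PiLp.smul_apply, smul_eq_mul]
        exact mul_ne_zero hc (ne_zero_of_mem_unitCube hn ht i))
  simp only [mul_one, one_pow] at key
  have hi : ∀ l ∈ Finset.univ, Integrable (fun t => h l * absPow ((2 * Real.pi * ρ) • t)
      (fun i => 2 * r l i)) (volume.restrict (unitCube n)) := fun l _ =>
    (integrableOn_absPow_unitCube hn hc _).const_mul _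
  have e2 : ∫⁻ t in unitCube n, ENNReal.ofReal (powSum r h ((2 * Real.pi * ρ) • t)) =
      ENNReal.ofReal D := by
    unfold powSum
    rw [← ofReal_integral_eq_lintegral_ofReal (integrable_finsetSum _ hi)
      (Eventually.of_forall fun t => powSum_nonneg hh _)]
    congr 1
    rw [integral_finsetSum _ hi]
    simp only [integral_const_mul, hD]
  rw [e2, ← ofReal_integral_eq_lintegral_ofReal (integrableOn_absPow_unitCube hn hc _)
    (Eventually.of_forall fun t => absPow_nonneg _ _), ← ENNReal.ofReal_pow
    (integral_nonneg fun t => absPow_nonneg _ _)] at key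
  rw [meshTerm, ← hD, ENNReal.ofReal_div_of_pos hDpos]
  refine ENNReal.div_le_of_le_mul (key.trans_eq ?_)
  congr 1
  refine lintegral_congr fun t => ?_
  rw [powRatio, absPow_two_mul, smul_smul]

theorem ofReal_pow_mul_meshTerm {h : Fin (m + 1) → ℝ} {ρ : ℝ} (hρ : 0 < ρ) (n : Fin d → ℤ) :
    ENNReal.ofReal (ρ ^ d * (∫ t in unitCube n, absPow ((2 * Real.pi * ρ) • t) k) ^ 2 /
          ∑ l, h l * ∫ t in unitCube n, absPow ((2 * Real.pi * ρ) • t) (fun i => 2 * r l i)) =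
      ENNReal.ofReal (ρ ^ d) * ENNReal.ofReal (meshTerm k r h ρ n) := by
  rw [← ENNReal.ofReal_mul (by positivity), meshTerm, mul_div_assoc]

/-- The cubes overlap in null sets, so their contributions add up to at most the full integral, and
ρ^d cancels the Jacobian of u = ρt. -/
theorem meshConst_le_taikovConst {ρ : ℝ} (hρ : 0 < ρ) :
    meshConst k r lam ρ ≤ taikovConst k r lam := by
  unfold meshConst
  refine iSup₂_le fun h hh => le_trans ?_ (le_taikovConst (k := k) (r := r) hh)
  refine mul_le_mul_right ?_ _
  simp only [ofReal_pow_mul_meshTerm hρ, ENNReal.tsum_mul_left]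
  have h1 : ∑' n : {n : Fin d → ℤ // ∀ i, n i ≠ 0}, ENNReal.ofReal (meshTerm k r h ρ n.1) ≤
      ∫⁻ t, ENNReal.ofReal (powRatio k r h ((2 * Real.pi) • (ρ • t))) := by
    refine (ENNReal.tsum_le_tsum fun n => ofReal_meshTerm_le hh hρ n.2).trans ?_
    have hU := lintegral_iUnion₀ (μ := volume)
      (s := fun n : {n : Fin d → ℤ // ∀ i, n i ≠ 0} => unitCube n.1)
      (fun n => (measurableSet_unitCube n.1).nullMeasurableSet)
      (fun n n' hnn => aedisjoint_unitCube fun h => hnn (Subtype.ext h))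
      (fun t => ENNReal.ofReal (powRatio k r h ((2 * Real.pi) • (ρ • t))))
    exact hU.symm.trans_le (setLIntegral_le_lintegral _ _)
  rw [lintegral_comp_smul (F := fun u => ENNReal.ofReal (powRatio k r h ((2 * Real.pi) • u))) hρ
    (measurable_powRatio_smul _).ennreal_ofReal] at h1
  refine (mul_le_mul_right h1 _).trans_eq ?_
  rw [← mul_assoc, ← ENNReal.ofReal_mul (by positivity), mul_inv_cancel₀ (by positivity),
    ENNReal.ofReal_one, one_mul]

/-- The index of the mesh cell of size `ρ` containing `u`. -/
def meshIndex (ρ : ℝ) (u : EuclideanSpace ℝ (Fin d)) : Fin d → ℤ := fun i => round (u i / ρ)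

theorem measurable_meshIndex (ρ : ℝ) :
    Measurable (meshIndex ρ : EuclideanSpace ℝ (Fin d) → Fin d → ℤ) := by
  refine measurable_pi_iff.2 fun i => ?_
  simp only [meshIndex, round_eq]
  refine Int.measurable_floor.comp ?_
  fun_prop

theorem volume_meshIndex_preimage_le {ρ : ℝ} (hρ : 0 < ρ) (n : Fin d → ℤ) :
    volume (meshIndex ρ ⁻¹' {n} : Set (EuclideanSpace ℝ (Fin d))) ≤ ENNReal.ofReal (ρ ^ d) := by
  have hsub : (meshIndex ρ ⁻¹' {n} : Set (EuclideanSpace ℝ (Fin d))) ⊆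
      (fun u => ρ⁻¹ • u) ⁻¹' unitCube n := by
    intro u hu i
    have : round (u i / ρ) = n i := congrFun hu i
    rw [← this, PiLp.smul_apply, smul_eq_mul, inv_mul_eq_div]
    exact abs_sub_round _
  refine (measure_mono hsub).trans_eq ?_
  rw [Measure.addHaar_preimage_smul _ (inv_ne_zero hρ.ne'), volume_unitCube, mul_one]
  simp [abs_of_pos hρ]

theorem eventually_meshIndex_ne_zero {u : EuclideanSpace ℝ (Fin d)} (hu : ∀ i, u i ≠ 0) :
    ∀ᶠ ρ in 𝓝[>] (0 : ℝ), ∀ i, meshIndex ρ u i ≠ 0 := by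
  rw [eventually_all]
  intro i
  have h1 : ∀ᶠ ρ in 𝓝[>] (0 : ℝ), ρ < |u i| :=
    (eventually_lt_nhds (abs_pos.2 (hu i))).filter_mono nhdsWithin_le_nhds
  filter_upwards [h1, self_mem_nhdsWithin] with ρ h1 (hρ : 0 < ρ) h0
  have h2 := abs_sub_round (u i / ρ)
  rw [show round (u i / ρ) = 0 from h0, Int.cast_zero, sub_zero, abs_div, abs_of_pos hρ,
    div_le_iff₀ hρ] at h2
  linarith

theorem tendsto_meshIndex_integral {u : EuclideanSpace ℝ (Fin d)} (hu : ∀ i, u i ≠ 0)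
    (s : Fin d → ℝ) :
    Tendsto (fun ρ : ℝ => ∫ t in unitCube (meshIndex ρ u), absPow ((2 * Real.pi * ρ) • t) s)
      (𝓝[>] 0) (𝓝 (absPow ((2 * Real.pi) • u) s)) := by
  rw [Metric.tendsto_nhds]
  intro ε hε
  have hcont := continuousAt_absPow (two_pi_smul_ne_zero hu) s
  -- Continuity is transported to `Fin d → ℝ`, whose sup metric permits coordinatewise estimates.
  have hV := (hcont.comp_of_eq (f := fun v : Fin d → ℝ => WithLp.toLp 2 v)
    (x := WithLp.ofLp ((2 * Real.pi) • u)) (PiLp.continuous_toLp 2 _).continuousAt rfl)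
  obtain ⟨δ, hδ, hball⟩ := Metric.continuousAt_iff.1 hV (ε / 2) (half_pos hε)
  have hsmall : ∀ᶠ ρ in 𝓝[>] (0 : ℝ), ρ < δ / (2 * Real.pi) :=
    (eventually_lt_nhds (by positivity)).filter_mono nhdsWithin_le_nhds
  filter_upwards [hsmall, self_mem_nhdsWithin, eventually_meshIndex_ne_zero hu] with ρ h1
    (hρ : 0 < ρ) hn
  have hclose : ∀ t ∈ unitCube (meshIndex ρ u),
      ‖absPow ((2 * Real.pi * ρ) • t) s - absPow ((2 * Real.pi) • u) s‖ ≤ ε / 2 := by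
    intro t ht
    refine le_of_lt (hball (x := WithLp.ofLp ((2 * Real.pi * ρ) • t)) ?_)
    rw [lt_div_iff₀ (by positivity)] at h1
    refine lt_of_le_of_lt ((dist_pi_le_iff (by positivity)).2 fun i => ?_)
      (show 2 * Real.pi * ρ < δ by linarith)
    have h2 := ht i
    have h3 := abs_sub_round (u i / ρ)
    change |t i - (round (u i / ρ) : ℤ)| ≤ 1 / 2 at h2
    -- One half comes from the cube and one half from rounding; hence the scaled cube lies within
    -- 2πρ of 2πu.
    have h4 : |t i - u i / ρ| ≤ 1 := by
      rw [abs_le] at h2 h3 ⊢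
      constructor <;> linarith [h2.1, h2.2, h3.1, h3.2]
    rw [Real.dist_eq]
    have e : ((2 * Real.pi * ρ) • t) i - ((2 * Real.pi) • u) i =
        2 * Real.pi * ρ * (t i - u i / ρ) := by
      simp only [PiLp.smul_apply, smul_eq_mul]
      field_simp
    rw [e, abs_mul, abs_of_pos (show 0 < 2 * Real.pi * ρ by positivity)]
    exact mul_le_of_le_one_right (by positivity) h4
  have hv : volume.real (unitCube (meshIndex ρ u)) = 1 := by
    rw [measureReal_def, volume_unitCube, ENNReal.toReal_one]
  have hvt : volume (unitCube (meshIndex ρ u)) < ⊤ := by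
    rw [volume_unitCube]; exact ENNReal.one_lt_top
  have hconst : absPow ((2 * Real.pi) • u) s =
      ∫ _t in unitCube (meshIndex ρ u), absPow ((2 * Real.pi) • u) s := by
    rw [setIntegral_const, hv, one_smul]
  rw [dist_eq_norm]
  rw [hconst, ← integral_sub (integrableOn_absPow_unitCube hn (by positivity) s)
    (integrableOn_const hvt.ne)]
  refine lt_of_le_of_lt (norm_setIntegral_le_of_norm_le_const hvt hclose) ?_
  rw [hv]
  linarith

theorem tendsto_meshTerm {h : Fin (m + 1) → ℝ} (hh : ∀ j, 0 < h j)
    {u : EuclideanSpace ℝ (Fin d)} (hu : ∀ i, u i ≠ 0) :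
    Tendsto (fun ρ : ℝ => meshTerm k r h ρ (meshIndex ρ u)) (𝓝[>] 0)
      (𝓝 (powRatio k r h ((2 * Real.pi) • u))) := by
  unfold meshTerm powRatio
  rw [absPow_two_mul]
  exact ((tendsto_meshIndex_integral hu k).pow 2).div
    (tendsto_finsetSum _ fun l _ => (tendsto_meshIndex_integral hu _).const_mul _)
    (powSum_pos hh (two_pi_smul_ne_zero hu)).ne'

/-- For fixed h the mesh sum dominates the integral of the step function equal to the mesh term of
the cell of u. This converges to the integrand almost everywhere, so Fatou's lemma applies. -/
theorem taikovConst_le_liminf_meshConst :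
    taikovConst k r lam ≤ liminf (fun ρ : ℝ => meshConst k r lam ρ) (𝓝[>] 0) := by
  classical
  rw [taikovConst_eq]
  refine iSup₂_le fun h hh => ?_
  set c := ENNReal.ofReal (∏ j, h j ^ lam j)
  let s : Set (Fin d → ℤ) := {n | ∀ i, n i ≠ 0}
  -- The indicator discards the cells absent from the mesh sum; a point with nonzero coordinates
  -- avoids them once ρ is small.
  let T : ℝ → (Fin d → ℤ) → ℝ≥0∞ := fun ρ =>
    s.indicator fun n => ENNReal.ofReal (meshTerm k r h ρ n)
  have hT : ∀ ρ, Measurable (T ρ) := fun ρ => measurable_of_countable _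
  have hm : ∀ ρ, Measurable fun u : EuclideanSpace ℝ (Fin d) => c * T ρ (meshIndex ρ u) :=
    fun ρ => ((hT ρ).comp (measurable_meshIndex ρ)).const_mul c
  have hlim : ∀ᵐ u : EuclideanSpace ℝ (Fin d),
      liminf (fun ρ : ℝ => c * T ρ (meshIndex ρ u)) (𝓝[>] 0) =
        c * ENNReal.ofReal (powRatio k r h ((2 * Real.pi) • u)) := by
    filter_upwards [ae_coord_ne_zero] with u hu
    suffices hT' : Tendsto (fun ρ : ℝ => T ρ (meshIndex ρ u)) (𝓝[>] 0)
        (𝓝 (ENNReal.ofReal (powRatio k r h ((2 * Real.pi) • u)))) from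
      (ENNReal.Tendsto.const_mul hT' (Or.inr ENNReal.ofReal_ne_top)).liminf_eq
    refine (ENNReal.tendsto_ofReal (tendsto_meshTerm (k := k) (r := r) hh hu)).congr' ?_
    filter_upwards [eventually_meshIndex_ne_zero hu] with ρ hρ
    exact (Set.indicator_of_mem (s := s) hρ fun n =>
      ENNReal.ofReal (meshTerm k r h ρ n)).symm
  have hfatou := lintegral_liminf_le (μ := volume) (u := 𝓝[>] (0 : ℝ)) hm
  rw [lintegral_congr_ae hlim, lintegral_const_mul _
    (measurable_powRatio_smul _).ennreal_ofReal] at hfatou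
  refine hfatou.trans (liminf_le_liminf ?_)
  filter_upwards [self_mem_nhdsWithin] with ρ (hρ : 0 < ρ)
  rw [lintegral_const_mul (f := fun u => T ρ (meshIndex ρ u)) _
    ((hT ρ).comp (measurable_meshIndex ρ))]
  refine le_trans (mul_le_mul_right ?_ _) (le_iSup₂_of_le h hh le_rfl)
  simp only [ofReal_pow_mul_meshTerm hρ]
  -- The image of Lebesgue measure under `meshIndex ρ` turns the integral into a countable sum with
  -- weights at most ρ^d.
  rw [← lintegral_map (hT ρ) (measurable_meshIndex ρ), lintegral_countable']
  refine le_trans ?_ (tsum_subtype s fun n =>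
    ENNReal.ofReal (ρ ^ d) * ENNReal.ofReal (meshTerm k r h ρ n)).ge
  refine ENNReal.tsum_le_tsum fun n => ?_
  rw [Measure.map_apply (measurable_meshIndex ρ) (measurableSet_singleton n)]
  by_cases hn : n ∈ s
  · simp only [T, Set.indicator_of_mem hn]
    rw [mul_comm]
    exact mul_le_mul_left (volume_meshIndex_preimage_le hρ n) _
  · simp [T, Set.indicator_of_notMem hn]

theorem liminf_meshConst :
    liminf (fun ρ : ℝ => meshConst k r lam ρ) (𝓝[>] 0) = taikovConst k r lam := by
  refine le_antisymm ?_ taikovConst_le_liminf_meshConst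
  refine (liminf_le_liminf (v := fun _ => taikovConst k r lam) ?_).trans_eq (liminf_const _)
  filter_upwards [self_mem_nhdsWithin] with ρ hρ using meshConst_le_taikovConst hρ

end Mesh

/-! ### Exhaustion by compact sets off the coordinate hyperplanes -/

/-- The set of points whose coordinates have absolute value between `1 / (n + 1)` and `n + 1`. -/
def coordBox {d : ℕ} (n : ℕ) : Set (EuclideanSpace ℝ (Fin d)) :=
  {u | ∀ i, ((n : ℝ) + 1)⁻¹ ≤ |u i| ∧ |u i| ≤ n + 1}

section CoordBox

variable {d : ℕ}

theorem coordBox_coord_ne_zero {n : ℕ} {u : EuclideanSpace ℝ (Fin d)} (hu : u ∈ coordBox n)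
    (i : Fin d) : u i ≠ 0 :=
  abs_pos.1 (lt_of_lt_of_le (by positivity) (hu i).1)

theorem isCompact_coordBox (n : ℕ) : IsCompact (coordBox n : Set (EuclideanSpace ℝ (Fin d))) := by
  have h : (coordBox n : Set (EuclideanSpace ℝ (Fin d))) =
      (EuclideanSpace.equiv (Fin d) ℝ).toHomeomorph ⁻¹' Set.pi Set.univ fun _ =>
        Set.Icc (-((n : ℝ) + 1)) (n + 1) ∩ {a : ℝ | ((n : ℝ) + 1)⁻¹ ≤ |a|} := by
    ext u
    simp only [coordBox, Set.mem_preimage, Set.mem_univ_pi]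
    refine forall_congr' fun i => ?_
    exact and_comm.trans (and_congr_left fun _ => abs_le)
  rw [h, Homeomorph.isCompact_preimage]
  exact isCompact_univ_pi fun i =>
    isCompact_Icc.inter_right (isClosed_le continuous_const continuous_abs)

theorem measurableSet_coordBox (n : ℕ) :
    MeasurableSet (coordBox n : Set (EuclideanSpace ℝ (Fin d))) :=
  (isCompact_coordBox n).isClosed.measurableSet

theorem monotone_coordBox : Monotone (coordBox : ℕ → Set (EuclideanSpace ℝ (Fin d))) := by
  intro n n' hn u hu i
  have h : (n : ℝ) + 1 ≤ n' + 1 := by exact_mod_cast Nat.add_le_add_right hn 1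
  exact ⟨(inv_anti₀ (by positivity) h).trans (hu i).1, (hu i).2.trans h⟩

theorem mem_iUnion_coordBox {u : EuclideanSpace ℝ (Fin d)} (hu : ∀ i, u i ≠ 0) :
    u ∈ ⋃ n, (coordBox n : Set (EuclideanSpace ℝ (Fin d))) := by
  have h : ∀ i, ∀ᶠ n : ℕ in atTop, ((n : ℝ) + 1)⁻¹ ≤ |u i| ∧ |u i| ≤ n + 1 := by
    intro i
    have h1 : Tendsto (fun n : ℕ => (n : ℝ) + 1) atTop atTop :=
      tendsto_atTop_add_const_right _ _ tendsto_natCast_atTop_atTop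
    exact ((h1.inv_tendsto_atTop).eventually_le_const (abs_pos.2 (hu i))).and
      (h1.eventually_ge_atTop _)
  obtain ⟨n, hn⟩ := (eventually_all.2 h).exists
  exact Set.mem_iUnion.2 ⟨n, hn⟩

theorem continuousAt_absPow_smul {u : EuclideanSpace ℝ (Fin d)} (hu : ∀ i, u i ≠ 0)
    (s : Fin d → ℝ) :
    ContinuousAt (fun u : EuclideanSpace ℝ (Fin d) => absPow ((2 * Real.pi) • u) s) u :=
  ContinuousAt.comp (f := fun u : EuclideanSpace ℝ (Fin d) => (2 * Real.pi) • u)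
    (continuousAt_absPow (two_pi_smul_ne_zero hu) s) (continuous_const_smul _).continuousAt

/-- Only the norm has to be continuous, so the sign jumps in the phase of `symbol` need no
discussion. -/
theorem memLp_indicator_coordBox {F : EuclideanSpace ℝ (Fin d) → ℂ} (hF : Measurable F) (n : ℕ)
    (hc : ContinuousOn (fun u => ‖F u‖) (coordBox n)) (p : ℝ≥0∞) :
    MemLp ((coordBox n).indicator F) p := by
  rw [memLp_indicator_iff_restrict (measurableSet_coordBox n)]
  obtain ⟨C, hC⟩ := (isCompact_coordBox n).exists_bound_of_continuousOn hc
  have : IsFiniteMeasure (volume.restrict (coordBox n : Set (EuclideanSpace ℝ (Fin d)))) :=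
    isFiniteMeasure_restrict.2 (isCompact_coordBox n).measure_lt_top.ne
  refine MemLp.of_bound hF.aestronglyMeasurable C
    (ae_restrict_of_forall_mem (measurableSet_coordBox n) fun u hu => ?_)
  simpa using hC u hu

end CoordBox

theorem HasFourierTransform.memSobolev {d : ℕ} {r : Fin d → ℝ}
    {x g : EuclideanSpace ℝ (Fin d) → ℂ} (hx : HasFourierTransform x g)
    (hr : MemLp (fun u => symbol r u * g u) 2) : MemSobolev r x := by
  refine ⟨g, hx, ?_⟩
  have h := ((memLp_two_iff_integrable_sq_norm hr.1).1 hr).2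
  rw [hasFiniteIntegral_iff_ofReal (Eventually.of_forall fun u => by positivity)] at h
  refine lt_of_eq_of_lt (lintegral_congr fun u => ?_) h
  rw [norm_mul, mul_pow, norm_symbol, absPow_two_mul]

theorem HasFourierTransform.memLp_two {d : ℕ} {x g : EuclideanSpace ℝ (Fin d) → ℂ}
    (hx : HasFourierTransform x g) (hg : MemLp g 2) : MemLp x 2 :=
  (memLp_congr_ae (hx.ae_eq_left (hasFourierTransform_fourierInv_Lp hg.toLp)
    hg.coeFn_toLp.symm)).2 (Lp.memLp _)

/-! ### Sharpness -/

section Sharpness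

variable {d m : ℕ} {k : Fin d → ℝ} {r : Fin (m + 1) → Fin d → ℝ} {lam : Fin (m + 1) → ℝ}

theorem taikovConst_ne_zero : taikovConst k r lam ≠ 0 := by
  intro h0
  have h1 := le_taikovConst (k := k) (r := r) (lam := lam) (h := fun _ => 1) fun _ => one_pos
  rw [h0] at h1
  simp only [Real.one_rpow, Finset.prod_const_one, ENNReal.ofReal_one, one_mul,
    nonpos_iff_eq_zero] at h1
  rw [lintegral_eq_zero_iff (measurable_powRatio_smul _).ennreal_ofReal] at h1
  have h2 : ∀ᵐ _u : EuclideanSpace ℝ (Fin d), False := by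
    filter_upwards [h1, ae_coord_ne_zero] with u hu hu'
    have := powRatio_pos (k := k) (r := r) (h := fun _ => 1) (fun _ => one_pos)
      (two_pi_smul_ne_zero hu')
    exact absurd hu (by simpa using this)
  exact h2.exists.choose_spec

/-- A truncated extremal symbol: the conjugate of `(2πiu)^k` divided by `∑ h_l |2πu|^{2 r^l}`. -/
def extremal (k : Fin d → ℝ) (r : Fin (m + 1) → Fin d → ℝ) (h : Fin (m + 1) → ℝ) (n : ℕ) :
    EuclideanSpace ℝ (Fin d) → ℂ :=
  (coordBox n).indicator fun u =>
    (starRingEnd ℂ) (symbol k u) / ((powSum r h ((2 * Real.pi) • u) : ℝ) : ℂ)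

theorem continuousOn_powSum_smul {h : Fin (m + 1) → ℝ} (n : ℕ) :
    ContinuousOn (fun u : EuclideanSpace ℝ (Fin d) => powSum r h ((2 * Real.pi) • u))
      (coordBox n) := fun u hu => by
  refine ContinuousAt.continuousWithinAt ?_
  unfold powSum
  exact tendsto_finsetSum _ fun l _ =>
    (continuousAt_absPow_smul (coordBox_coord_ne_zero hu) _).const_mul _

theorem continuousOn_absPow_smul (s : Fin d → ℝ) (n : ℕ) :
    ContinuousOn (fun u : EuclideanSpace ℝ (Fin d) => absPow ((2 * Real.pi) • u) s)
      (coordBox n) := fun _ hu =>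
  (continuousAt_absPow_smul (coordBox_coord_ne_zero hu) _).continuousWithinAt

theorem measurable_conj_symbol_div_powSum {h : Fin (m + 1) → ℝ} :
    Measurable fun u : EuclideanSpace ℝ (Fin d) =>
      (starRingEnd ℂ) (symbol k u) / ((powSum r h ((2 * Real.pi) • u) : ℝ) : ℂ) :=
  (Complex.continuous_conj.measurable.comp (measurable_symbol k)).div
    (Complex.measurable_ofReal.comp (measurable_powSum.comp (measurable_const_smul _)))

theorem memLp_extremal {h : Fin (m + 1) → ℝ} (hh : ∀ j, 0 < h j) (n : ℕ) (p : ℝ≥0∞) :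
    MemLp (extremal k r h n) p := by
  have hc : ContinuousOn (fun u : EuclideanSpace ℝ (Fin d) =>
      ‖(starRingEnd ℂ) (symbol k u) / ((powSum r h ((2 * Real.pi) • u) : ℝ) : ℂ)‖)
      (coordBox n) := by
    simp only [norm_div, RCLike.norm_conj, norm_symbol, Complex.norm_real]
    exact (continuousOn_absPow_smul k n).div (continuousOn_powSum_smul n).norm fun u hu =>
      norm_ne_zero_iff.2
        (powSum_pos hh (two_pi_smul_ne_zero (coordBox_coord_ne_zero hu))).ne'
  exact memLp_indicator_coordBox measurable_conj_symbol_div_powSum n hc p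

theorem memLp_symbol_mul_extremal {h : Fin (m + 1) → ℝ} (hh : ∀ j, 0 < h j) (s : Fin d → ℝ)
    (n : ℕ) (p : ℝ≥0∞) : MemLp (fun u => symbol s u * extremal k r h n u) p := by
  have e : (fun u => symbol s u * extremal k r h n u) = (coordBox n).indicator fun u =>
      symbol s u * ((starRingEnd ℂ) (symbol k u) /
        ((powSum r h ((2 * Real.pi) • u) : ℝ) : ℂ)) := by
    funext u
    exact (Set.indicator_mul_right _ _ _).symm
  rw [e]
  refine memLp_indicator_coordBox ((measurable_symbol s).mul measurable_conj_symbol_div_powSum) n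
    (ContinuousOn.congr (f := fun u => absPow ((2 * Real.pi) • u) s *
      (absPow ((2 * Real.pi) • u) k / ‖powSum r h ((2 * Real.pi) • u)‖)) ?_ fun u _ => ?_) p
  swap
  · simp only [Pi.mul_apply, norm_mul, norm_div, RCLike.norm_conj, norm_symbol, Complex.norm_real]
  exact (continuousOn_absPow_smul s n).mul <|
    (continuousOn_absPow_smul k n).div (continuousOn_powSum_smul n).norm fun u hu =>
      norm_ne_zero_iff.2
        (powSum_pos hh (two_pi_smul_ne_zero (coordBox_coord_ne_zero hu))).ne'

theorem symbol_mul_extremal {h : Fin (m + 1) → ℝ} (n : ℕ) (u : EuclideanSpace ℝ (Fin d)) :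
    symbol k u * extremal k r h n u =
      (((coordBox n).indicator (fun u => powRatio k r h ((2 * Real.pi) • u)) u : ℝ) : ℂ) := by
  by_cases hu : u ∈ coordBox n
  · rw [extremal, Set.indicator_of_mem hu, Set.indicator_of_mem hu, ← mul_div_assoc,
      Complex.mul_conj, Complex.normSq_eq_norm_sq, norm_symbol, ← absPow_two_mul, powRatio,
      Complex.ofReal_div]
  · rw [extremal, Set.indicator_of_notMem hu, Set.indicator_of_notMem hu, mul_zero,
      Complex.ofReal_zero]

/-- Together with `symbol_mul_extremal` this is the equality case: the same function integrates to
D^k x at the origin and to ∑ h_l ‖D^{r^l} x‖². -/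
theorem powSum_mul_norm_sq_extremal {h : Fin (m + 1) → ℝ} (hh : ∀ j, 0 < h j) (n : ℕ)
    (u : EuclideanSpace ℝ (Fin d)) :
    powSum r h ((2 * Real.pi) • u) * ‖extremal k r h n u‖ ^ 2 =
      (coordBox n).indicator (fun u => powRatio k r h ((2 * Real.pi) • u)) u := by
  by_cases hu : u ∈ coordBox n
  · have hS := powSum_pos (r := r) hh (two_pi_smul_ne_zero (coordBox_coord_ne_zero hu))
    rw [extremal, Set.indicator_of_mem hu, Set.indicator_of_mem hu, norm_div, RCLike.norm_conj,
      norm_symbol, Complex.norm_real, Real.norm_of_nonneg hS.le, powRatio, absPow_two_mul]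
    field_simp
  · rw [extremal, Set.indicator_of_notMem hu, Set.indicator_of_notMem hu]
    simp

theorem exists_lt_norm_fracDeriv (hlam : ∀ j, 0 < lam j) (hsum : ∑ j, lam j = 1)
    (hC : taikovConst k r lam ≠ ⊤) {K : ℝ}
    (hK : K < √((taikovConst k r lam).toReal * ∏ j, lam j ^ (-lam j))) :
    ∃ x : EuclideanSpace ℝ (Fin d) → ℂ, MemLp x 2 ∧ (∀ l, MemSobolev (r l) x) ∧
      ∃ (y : EuclideanSpace ℝ (Fin d) →ᵇ ℂ)
        (z : Fin (m + 1) → Lp ℂ 2 (volume : Measure (EuclideanSpace ℝ (Fin d)))),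
        IsFracDeriv k x y ∧ (∀ l, IsFracDeriv (r l) x (z l)) ∧ K * ∏ j, ‖z j‖ ^ lam j < ‖y‖ := by
  set Λ : ℝ := ∏ j, lam j ^ lam j with hΛ
  have hΛ0 : 0 < Λ := Finset.prod_pos fun j _ => Real.rpow_pos_of_pos (hlam j) _
  have hΛinv : ∏ j, lam j ^ (-lam j) = Λ⁻¹ := by
    rw [hΛ, ← Finset.prod_inv_distrib]
    exact Finset.prod_congr rfl fun j _ => Real.rpow_neg (hlam j).le _
  have hCpos : 0 < (taikovConst k r lam).toReal := ENNReal.toReal_pos taikovConst_ne_zero hC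
  rw [hΛinv] at hK
  -- Replacing K by max(K, 0) allows squaring; the constant is positive, so the strict bound
  -- survives.
  have hK' : max K 0 < √((taikovConst k r lam).toReal * Λ⁻¹) :=
    max_lt hK (Real.sqrt_pos.2 (by positivity))
  set K' := max K 0
  have hK0 : 0 ≤ K' := le_max_right _ _
  have hKC : ENNReal.ofReal (K' ^ 2 * Λ) < taikovConst k r lam := by
    rw [ENNReal.ofReal_lt_iff_lt_toReal (by positivity) hC]
    rw [Real.lt_sqrt hK0, ← div_eq_mul_inv, lt_div_iff₀ hΛ0] at hK'
    exact hK'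
  rw [taikovConst_eq] at hKC
  obtain ⟨h, hKC⟩ := lt_iSup_iff.1 hKC
  obtain ⟨hh, hKC⟩ := lt_iSup_iff.1 hKC
  -- Monotone convergence over the boxes: some finite box already beats K'² Λ.
  have hU : ∫⁻ u : EuclideanSpace ℝ (Fin d), ENNReal.ofReal (powRatio k r h ((2 * Real.pi) • u)) =
      ⨆ n, ∫⁻ u in coordBox n, ENNReal.ofReal (powRatio k r h ((2 * Real.pi) • u)) := by
    rw [← setLIntegral_iUnion_of_directed _ monotone_coordBox.directed_le, ← setLIntegral_univ]
    refine setLIntegral_congr (EventuallyEq.symm (eventuallyEq_univ.2 ?_))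
    filter_upwards [ae_coord_ne_zero] with u hu using mem_iUnion_coordBox hu
  rw [hU, ENNReal.mul_iSup] at hKC
  obtain ⟨n, hn⟩ := lt_iSup_iff.1 hKC
  have hpi : Integrable ((coordBox n).indicator fun u : EuclideanSpace ℝ (Fin d) =>
      powRatio k r h ((2 * Real.pi) • u)) := by
    have := memLp_one_iff_integrable.1 (memLp_symbol_mul_extremal (k := k) (r := r) hh k n 1)
    simp only [symbol_mul_extremal] at this
    simpa using this.re
  have hpn : ∀ u, 0 ≤ (coordBox n).indicator (fun u : EuclideanSpace ℝ (Fin d) =>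
      powRatio k r h ((2 * Real.pi) • u)) u := fun u =>
    Set.indicator_nonneg (fun u _ => powRatio_nonneg hh _) u
  set A : ℝ := ∫ u, (coordBox n).indicator (fun u : EuclideanSpace ℝ (Fin d) =>
      powRatio k r h ((2 * Real.pi) • u)) u with hA
  have hlin : ∫⁻ u, ENNReal.ofReal ((coordBox n).indicator (fun u : EuclideanSpace ℝ (Fin d) =>
      powRatio k r h ((2 * Real.pi) • u)) u) = ENNReal.ofReal A :=
    (ofReal_integral_eq_lintegral_ofReal hpi (Eventually.of_forall hpn)).symm
  have hA0 : 0 ≤ A := integral_nonneg hpn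
  have hbox : ∫⁻ u in coordBox n, ENNReal.ofReal (powRatio k r h ((2 * Real.pi) • u)) =
      ENNReal.ofReal A := by
    rw [← hlin, ← lintegral_indicator (measurableSet_coordBox n)]
    refine lintegral_congr fun u => ?_
    by_cases hu : u ∈ coordBox n <;> simp [hu]
  set H : ℝ := ∏ j, h j ^ lam j with hH
  have hH0 : 0 < H := Finset.prod_pos fun j _ => Real.rpow_pos_of_pos (hh j) _
  rw [hbox, ← ENNReal.ofReal_mul hH0.le, ENNReal.ofReal_lt_ofReal_iff_of_nonneg (by positivity)] at hn
  have hgi : Integrable (extremal k r h n) := memLp_one_iff_integrable.1 (memLp_extremal hh n 1)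
  have hx := hasFourierTransform_fourierInv hgi
  have hI : Integrable fun u => symbol k u * extremal k r h n u :=
    memLp_one_iff_integrable.1 (memLp_symbol_mul_extremal hh k n 1)
  have hM : ∀ l, MemLp (fun u => symbol (r l) u * extremal k r h n u) 2 := fun l =>
    memLp_symbol_mul_extremal hh (r l) n 2
  refine ⟨_, hx.memLp_two (memLp_extremal hh n 2), fun l => hx.memSobolev (hM l),
    fourierInvBCF _ hI, fun l => 𝓕⁻ (hM l).toLp, isFracDeriv_fourierInvBCF hx hI,
    fun l => isFracDeriv_fourierInv_toLp hx (hM l), ?_⟩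
  simp only [norm_fourierInv_Lp]
  have hy : A ≤ ‖fourierInvBCF _ hI‖ := by
    refine le_trans ?_ ((fourierInvBCF _ hI).norm_coe_le_norm 0)
    rw [fourierInvBCF_zero]
    simp only [symbol_mul_extremal]
    rw [integral_complex_ofReal, Complex.norm_real]
    exact le_abs_self _
  have hS : ∑ l, h l * ‖(hM l).toLp‖ ^ 2 = A := by
    have e := lintegral_powSum_mul_sq hh hM
    simp only [powSum_mul_norm_sq_extremal hh] at e
    rw [hlin] at e
    exact ((ENNReal.ofReal_eq_ofReal_iff hA0 (Finset.sum_nonneg fun l _ =>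
      mul_nonneg (hh l).le (sq_nonneg _))).1 e).symm
  set N : Fin (m + 1) → ℝ := fun l => ‖(hM l).toLp‖
  have hN : ∀ l, 0 ≤ N l := fun l => norm_nonneg _
  change K * ∏ j, N j ^ lam j < _
  set P : ℝ := ∏ j, N j ^ lam j with hP
  have hP0 : 0 ≤ P := Finset.prod_nonneg fun j _ => Real.rpow_nonneg (hN j) _
  -- Weighted AM–GM for the numbers h_j N_j² / λ_j, whose λ-mean is ∑ h_j N_j² = A.
  have hamgm : H * P ^ 2 * Λ⁻¹ ≤ A := by
    have key := Real.geom_mean_le_arith_mean_weighted Finset.univ lam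
      (fun j => h j * N j ^ 2 / lam j) (fun j _ => (hlam j).le) hsum
      (fun j _ => div_nonneg (mul_nonneg (hh j).le (sq_nonneg _)) (hlam j).le)
    calc _ = _ := ?_
      _ ≤ _ := key
      _ = _ := ?_
    · rw [hH, hP, hΛ, ← Finset.prod_pow, ← Finset.prod_inv_distrib, ← Finset.prod_mul_distrib,
        ← Finset.prod_mul_distrib]
      refine Finset.prod_congr rfl fun j _ => ?_
      rw [Real.div_rpow (mul_nonneg (hh j).le (sq_nonneg _)) (hlam j).le,
        Real.mul_rpow (hh j).le (sq_nonneg _), ← Real.rpow_natCast_mul (hN j),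
        ← Real.rpow_mul_natCast (hN j), mul_comm (lam j), div_eq_mul_inv]
    · rw [← hS]
      refine Finset.sum_congr rfl fun j _ => ?_
      exact mul_div_cancel₀ _ (hlam j).ne'
  have hApos : 0 < A := by
    by_contra hcon
    have : A = 0 := le_antisymm (not_lt.1 hcon) hA0
    rw [this, mul_zero] at hn
    exact absurd hn (not_lt.2 (by positivity))
  -- AM–GM gives H P² ≤ A Λ and the choice of h and the box gives K'² Λ < H A; multiplied together
  -- they yield H (K' P)² < H A².
  have hlt : K' * P < A := by
    refine lt_of_pow_lt_pow_left₀ 2 hA0 ?_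
    refine lt_of_mul_lt_mul_left ?_ hH0.le
    rw [← div_eq_mul_inv, div_le_iff₀ hΛ0] at hamgm
    calc H * (K' * P) ^ 2 = K' ^ 2 * (H * P ^ 2) := by ring
      _ ≤ K' ^ 2 * (A * Λ) := mul_le_mul_of_nonneg_left hamgm (sq_nonneg _)
      _ = A * (K' ^ 2 * Λ) := by ring
      _ < A * (H * A) := mul_lt_mul_of_pos_left hn hApos
      _ = H * A ^ 2 := by ring
  exact lt_of_le_of_lt (mul_le_mul_of_nonneg_right (le_max_left _ _) hP0) (hlt.trans_le hy)

end Sharpness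

end TaikovRd

end

theorem theorem5p9 (d m : ℕ) (hd : 1 ≤ d) (hm : 1 ≤ m)
    (k : Fin d → ℝ) (r : Fin (m + 1) → Fin d → ℝ) (lam : Fin (m + 1) → ℝ)
    (hlam_pos : ∀ j, 0 < lam j) (hlam_sum : ∑ j, lam j = 1)
    (hk : ∀ i, k i + 1 / 2 = ∑ j, lam j * r j i)
    (hk_int : (fun i => k i + 1 / 2) ∈ interior (convexHull ℝ (Set.range r))) :
    -- the two expressions for the constant agree, and the constant is finite
    (liminf (fun ρ : ℝ => TaikovRd.meshConst k r lam ρ) (𝓝[>] 0) =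
        TaikovRd.taikovConst k r lam ∧
      TaikovRd.taikovConst k r lam ≠ ⊤) ∧
    -- the derivatives exist (uniquely) in `C(ℝ^d)` and in `L₂(ℝ^d)`
    (∀ x : EuclideanSpace ℝ (Fin d) → ℂ, (∀ l, TaikovRd.MemSobolev (r l) x) →
      (∃! y : EuclideanSpace ℝ (Fin d) →ᵇ ℂ, TaikovRd.IsFracDeriv k x y) ∧
      ∀ l, ∃! z : Lp ℂ 2 (volume : Measure (EuclideanSpace ℝ (Fin d))),
        TaikovRd.IsFracDeriv (r l) x z) ∧
    -- the inequality
    (∀ x : EuclideanSpace ℝ (Fin d) → ℂ, (∀ l, TaikovRd.MemSobolev (r l) x) →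
      ∀ (y : EuclideanSpace ℝ (Fin d) →ᵇ ℂ)
        (z : Fin (m + 1) → Lp ℂ 2 (volume : Measure (EuclideanSpace ℝ (Fin d)))),
        TaikovRd.IsFracDeriv k x y → (∀ l, TaikovRd.IsFracDeriv (r l) x (z l)) →
        ‖y‖ ≤ Real.sqrt ((TaikovRd.taikovConst k r lam).toReal * ∏ j, lam j ^ (-lam j)) *
          ∏ j, ‖z j‖ ^ lam j) ∧
    -- sharpness: no smaller constant works, even for square integrable functions
    (∀ K : ℝ,
      K < Real.sqrt ((TaikovRd.taikovConst k r lam).toReal * ∏ j, lam j ^ (-lam j)) →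
      ∃ x : EuclideanSpace ℝ (Fin d) → ℂ,
        MemLp x 2 ∧ (∀ l, TaikovRd.MemSobolev (r l) x) ∧
        ∃ (y : EuclideanSpace ℝ (Fin d) →ᵇ ℂ)
          (z : Fin (m + 1) → Lp ℂ 2 (volume : Measure (EuclideanSpace ℝ (Fin d)))),
          TaikovRd.IsFracDeriv k x y ∧ (∀ l, TaikovRd.IsFracDeriv (r l) x (z l)) ∧
          K * ∏ j, ‖z j‖ ^ lam j < ‖y‖) := by
  have hC := TaikovRd.taikovConst_ne_top hlam_pos hlam_sum hk hk_int
  exact ⟨⟨TaikovRd.liminf_meshConst, hC⟩,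
    fun x hx => TaikovRd.existsUnique_isFracDeriv hC hx,
    fun x hx y z hy hz => TaikovRd.norm_fracDeriv_le hlam_pos hlam_sum hC hx hy hz,
    fun K hK => TaikovRd.exists_lt_norm_fracDeriv hlam_pos hlam_sum hC hK⟩
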